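/- \textbf{Conventions.} A manifold is a smooth ($C^\infty$) manifold without boundary, Hausdorff and second countable, of some finite dimension. An \emph{immersed submanifold} of $M$ is a subset $L\subseteq M$ together with a manifold structure on $L$ (whose topology may be finer than the subspace topology) for which the inclusion $L\hookrightarrow M$ is an immersion. A \emph{singular distribution} on $M$ is a subset $\Delta\subseteq TM$ such that $\Delta_x:=\Delta\cap T_xM$ is a vector subspace of $T_xM$ for every $x\in M$, and such that for every $x\in M$ and $v\in\Delta_x$ there is a smooth vector field $X$ on an open neighbourhood $U$ of $x$ with $X_x=v$ and $X_y\in\Delta_y$ for all $y\in U$. An \emph{integral submanifold} of $\Delta$ is an immersed submanifold $L$ with $T_yL=\Delta_y$ for all $y\in L$; $\Delta$ is \emph{integrable} if every point of $M$ lies in some integral submanifold. A \emph{maximal integral submanifold} is a connected (nonempty) integral submanifold $L$ such that every connected integral submanifold $S$ with $S\cap L\neq\emptyset$ is contained in $L$ and is open in the manifold topology of $L$. The \emph{leaves} of an integrable $\Delta$ (that is, of the singular foliation it induces) are the sets underlying its maximal integral submanifolds. \textbf{Proposition 4.} Let $p\colon M\to N$ be a surjective submersion of manifolds whose fibers $p^{-1}(y)$,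 $y\in N$, are connected, and let $\Delta$ be an integrable singular distribution on $N$. Then \[(dp)^{-1}(\Delta)=\{v\in TM : dp(v)\in\Delta\}\] is an integrable singular distribution on $M$. Moreover its leaves are exactly the preimages of the leaves of $\Delta$: a subset $A\subseteq M$ is a leaf of $(dp)^{-1}(\Delta)$ if and only if $A=p^{-1}(L)$ for some leaf $L$ of $\Delta$. -/

import Mathlib

open scoped Manifold ContDiff

universe u v

namespace SingularFoliation

/-- The set of points of a subset `L ⊆ M`, as a type. It is a plain definition, so that it does not
inherit the subspace topology: an immersed submanifold carries its own topology. -/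
def Points {M : Type u} (L : Set M) : Type u := {x : M // x ∈ L}

/-- The inclusion `L → M`. -/
def incl {M : Type u} (L : Set M) : Points L → M := Subtype.val

/-- An immersed submanifold of an `m`-dimensional manifold `M`: a subset `carrier` with a manifold
structure (Hausdorff, second countable, smooth) for which the inclusion is an immersion. -/
structure ImmersedSubmanifold (m : ℕ) (M : Type u) [TopologicalSpace M]
    [ChartedSpace (EuclideanSpace ℝ (Fin m)) M] where
  /-- the underlying subset -/
  carrier : Set M
  /-- the dimension -/
  dim : ℕ
  /-- the manifold topology, in general finer than the subspace topology -/
  [topology : TopologicalSpace (Points carrier)]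
  /-- the atlas -/
  [charts : ChartedSpace (EuclideanSpace ℝ (Fin dim)) (Points carrier)]
  [isManifold : IsManifold (𝓡 dim) ∞ (Points carrier)]
  [t2 : T2Space (Points carrier)]
  [secondCountable : SecondCountableTopology (Points carrier)]
  isImmersion : Manifold.IsImmersion (𝓡 dim) (𝓡 m) ∞ (incl carrier)

attribute [instance] ImmersedSubmanifold.topology
attribute [instance] ImmersedSubmanifold.charts
attribute [instance] ImmersedSubmanifold.isManifold
attribute [instance] ImmersedSubmanifold.t2
attribute [instance] ImmersedSubmanifold.secondCountable

section

variable {m : ℕ} {M : Type u} [TopologicalSpace M] [ChartedSpace (EuclideanSpace ℝ (Fin m)) M]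
  [IsManifold (𝓡 m) ∞ M]

/-- The fibre `Δ_x ⊆ T_x M` of a subset `Δ` of the tangent bundle. -/
def fiber (Δ : Set (TangentBundle (𝓡 m) M)) (x : M) : Set (TangentSpace (𝓡 m) x) :=
  {v | (⟨x, v⟩ : TangentBundle (𝓡 m) M) ∈ Δ}

/-- The tangent space `T_y L`, as a subset of `T_y M`, at a point `y` of an immersed
submanifold `L`. -/
def ImmersedSubmanifold.tangent (L : ImmersedSubmanifold m M) (y : Points L.carrier) :
    Set (TangentSpace (𝓡 m) (incl L.carrier y)) :=
  Set.range (mfderiv (𝓡 L.dim) (𝓡 m) (incl L.carrier) y)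

/-- An immersed submanifold is connected (in its manifold topology; in particular nonempty). -/
def ImmersedSubmanifold.Connected (L : ImmersedSubmanifold m M) : Prop :=
  ConnectedSpace (Points L.carrier)

/-- A smooth singular distribution: a subset `Δ ⊆ TM` whose fibres are vector subspaces and such
that every `v ∈ Δ` is a value of a smooth vector field tangent to `Δ` on an open set. -/
structure IsSingularDistribution (Δ : Set (TangentBundle (𝓡 m) M)) : Prop where
  subspace : ∀ x : M, ∃ W : Submodule ℝ (TangentSpace (𝓡 m) x),
    (W : Set (TangentSpace (𝓡 m) x)) = fiber Δ x
  smooth : ∀ (x : M) (v : TangentSpace (𝓡 m) x), v ∈ fiber Δ x →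
    ∃ (U : Set M) (X : ∀ y : M, TangentSpace (𝓡 m) y), IsOpen U ∧ x ∈ U ∧
      ContMDiffOn (𝓡 m) (𝓡 m).tangent ∞ (fun y => (⟨y, X y⟩ : TangentBundle (𝓡 m) M)) U ∧
      X x = v ∧ ∀ y ∈ U, X y ∈ fiber Δ y

/-- `L` is an integral submanifold of `Δ`: `T_y L = Δ_y` for all `y ∈ L`. -/
def IsIntegral (Δ : Set (TangentBundle (𝓡 m) M)) (L : ImmersedSubmanifold m M) : Prop :=
  ∀ y : Points L.carrier, L.tangent y = fiber Δ (incl L.carrier y)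

/-- `Δ` is an integrable singular distribution: through every point there is an integral
submanifold. -/
structure IsIntegrable (Δ : Set (TangentBundle (𝓡 m) M)) : Prop where
  isSingularDistribution : IsSingularDistribution Δ
  exists_integral : ∀ x : M, ∃ L : ImmersedSubmanifold m M, x ∈ L.carrier ∧ IsIntegral Δ L

/-- A maximal integral submanifold: a connected one, such that every connected integral
submanifold meeting it is contained in it as an open subset for its manifold topology. -/
structure IsMaximalIntegral (Δ : Set (TangentBundle (𝓡 m) M)) (L : ImmersedSubmanifold m M) :
    Prop where
  isIntegral : IsIntegral Δ L
  connected : L.Connected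
  maximal : ∀ S : ImmersedSubmanifold m M, IsIntegral Δ S → S.Connected →
    (S.carrier ∩ L.carrier).Nonempty →
      S.carrier ⊆ L.carrier ∧ IsOpen (incl L.carrier ⁻¹' S.carrier)

/-- The leaves of (the singular foliation induced by) `Δ`: the subsets underlying its maximal
integral submanifolds. -/
def leaves (Δ : Set (TangentBundle (𝓡 m) M)) : Set (Set M) :=
  {A | ∃ L : ImmersedSubmanifold m M, L.carrier = A ∧ IsMaximalIntegral Δ L}

end

end SingularFoliation

/-! The ambient manifold is given a finer topology, the leaf topology. Near a point it is the
topology of an integral slice: the part of a chart domain lying over a linear subspace `W`, along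
which the distribution is the direction `W`. Integral submanifolds have this form locally
(`IsIntegral.exists_slice`). The construction works because two slices through a point agree near it
(`IsIntegralSlice.slice_mem_nhdsWithin`). The rank may jump off a slice but is constant along it,
and a Gronwall estimate for the distance to `W` (`eventually_mem_of_fderiv_mem_range`) gives this
uniqueness without flows.

Integral submanifolds are then open for the leaf topology and carry it as their own. Conversely,
leafwise open sets that are second countable and of constant rank are integral submanifolds
(`exists_immersedSubmanifold`). Hence the leaves are the connected components of the leaf topology
that are second countable (`mem_leaves_iff`). Second countability is carried along as a condition;
it is never proved for all components.

In charts where `p` is a linear projection, slices pull back to slices. So the leaf topology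
upstairs is induced by the identity to `M` and by `p` to the leaf space of `N`
(`nhds_leafSpace_preimage`). It follows that `p` is a continuous open surjection of leaf spaces. On
its fibres the leaf topology is the one from `M`, so they are connected. Such a map pulls components
back to components. Second countability descends along open surjections, and lifts because the
preimage of a component `C` has the topology induced from `M × C`. -/

namespace SingularFoliation

open Set Filter Topology

/-! ### A Gronwall criterion for staying in a linear subspace. -/

section Flat

variable {E : Type*} [NormedAddCommGroup E] [NormedSpace ℝ E]
  {H : Type*} [NormedAddCommGroup H] [InnerProductSpace ℝ H]

/-- A linear map close to the inclusion of a subspace is bounded below. -/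
lemma norm_le_two_mul_of_norm_sub_subtypeL_le {W : Submodule ℝ H} {S : W →L[ℝ] H}
    (hS : ‖S - W.subtypeL‖ ≤ 1 / 2) (w : W) : ‖w‖ ≤ 2 * ‖S w‖ := by
  have h1 : ‖(S - W.subtypeL) w‖ ≤ 1 / 2 * ‖w‖ :=
    (ContinuousLinearMap.le_opNorm _ _).trans (by gcongr)
  have h2 : (S - W.subtypeL) w = S w - (w : H) := rfl
  have h3 : ‖(w : H)‖ ≤ ‖S w‖ + ‖S w - (w : H)‖ := by
    have := norm_sub_le (S w) (S w - (w : H))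
    simpa using this
  rw [h2] at h1
  have h4 : ‖w‖ = ‖(w : H)‖ := rfl
  linarith

/-- If the derivative of `g` takes values in the distribution spanned by the fields `z ↦ T z w`,
whose restriction to `W` is tangent to `W` and is the identity at `g u₀ ∈ W`, then `g` stays in `W`
near `u₀`. -/
lemma eventually_mem_of_fderiv_mem_range [FiniteDimensional ℝ H] {W : Submodule ℝ H}
    {T : H → W →L[ℝ] H} {g : E → H} {u₀ : E} (hT : ContDiffAt ℝ 1 T (g u₀)) (hg : ContDiffAt ℝ 1 g u₀) (h0 : g u₀ ∈ W)
    (hT0 : T (g u₀) = W.subtypeL)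
    (hTW : ∀ᶠ z in 𝓝 (g u₀), z ∈ W → ∀ w, T z w ∈ W)
    (hrange : ∀ᶠ u in 𝓝 u₀, ∀ h, ∃ w, T (g u) w = fderiv ℝ g u h) :
    ∀ᶠ u in 𝓝 u₀, g u ∈ W := by
  -- `π z` is the component of `z` orthogonal to `W`; the goal is that it vanishes along `g`.
  set π : H →L[ℝ] H := Wᗮ.starProjection with hπ
  have hπW : ∀ z, π z = 0 ↔ z ∈ W := fun z ↦ by
    rw [hπ, Submodule.starProjection_orthogonal_val, sub_eq_zero, eq_comm,
      Submodule.starProjection_eq_self_iff]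
  have hπle : ∀ z, ‖π z‖ ≤ ‖z‖ := fun z ↦ Submodule.norm_starProjection_apply_le _ _
  have hρ : ∀ z, z - W.starProjection z = π z := fun z ↦
    (Submodule.starProjection_orthogonal_val z).symm
  obtain ⟨K, s, hs, hK⟩ := hT.exists_lipschitzOnWith
  have hρ0 : Tendsto (fun z ↦ W.starProjection z) (𝓝 (g u₀)) (𝓝 (g u₀)) := by
    have := (W.starProjection.continuous.tendsto (g u₀))
    rwa [(Submodule.starProjection_eq_self_iff).2 h0] at this
  have hnear : ∀ᶠ z in 𝓝 (g u₀), ‖T z - W.subtypeL‖ ≤ 1 / 2 := by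
    have := hT.continuousAt.tendsto
    rw [hT0] at this
    have := this.eventually (Metric.closedBall_mem_nhds _ (by norm_num : (0 : ℝ) < 1 / 2))
    simpa [dist_eq_norm] using this
  -- At the projection of `z` to `W` the fields are tangent to `W`, so only the Lipschitz variation
  -- of `T` over the distance `‖π z‖` contributes. The factor 2 trades the unknown parameter `w` for
  -- the vector `T z w` itself.
  have hbound : ∀ᶠ z in 𝓝 (g u₀), ∀ w, ‖π (T z w)‖ ≤ 2 * K * ‖π z‖ * ‖T z w‖ := by
    filter_upwards [hs, hρ0.eventually hs, hρ0.eventually hTW, hnear] with z h1 h2 h3 h4 w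
    have h5 : π (T (W.starProjection z) w) = 0 :=
      (hπW _).2 (h3 (Submodule.starProjection_apply_mem _ _) w)
    calc ‖π (T z w)‖ = ‖π ((T z - T (W.starProjection z)) w)‖ := by simp [h5]
      _ ≤ ‖(T z - T (W.starProjection z)) w‖ := hπle _
      _ ≤ ‖T z - T (W.starProjection z)‖ * ‖w‖ := ContinuousLinearMap.le_opNorm _ _
      _ ≤ (K * ‖z - W.starProjection z‖) * (2 * ‖T z w‖) := by
          gcongr
          · exact hK.norm_sub_le h1 h2
          · exact norm_le_two_mul_of_norm_sub_subtypeL_le h4 w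
      _ = 2 * K * ‖π z‖ * ‖T z w‖ := by rw [hρ]; ring
  have hdiff : ∀ᶠ u in 𝓝 u₀, DifferentiableAt ℝ g u := by
    filter_upwards [hg.eventually (by simp)] with u hu using hu.differentiableAt (by simp)
  have hC : ∀ᶠ u in 𝓝 u₀, ‖fderiv ℝ g u‖ ≤ ‖fderiv ℝ g u₀‖ + 1 := by
    have : ContinuousAt (fun u ↦ ‖fderiv ℝ g u‖) u₀ :=
      (hg.fderiv_right (m := 0) (by simp)).continuousAt.norm
    filter_upwards [this.eventually (Iio_mem_nhds (lt_add_one _))] with u hu using le_of_lt hu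
  obtain ⟨r, hr, hball⟩ := Metric.eventually_nhds_iff_ball.1
    ((hg.continuousAt.eventually hbound).and (hdiff.and (hC.and hrange)))
  filter_upwards [Metric.ball_mem_nhds u₀ hr] with u hu
  set C := ‖fderiv ℝ g u₀‖ + 1
  set γ : ℝ → E := fun t ↦ u₀ + t • (u - u₀)
  have hγ : ∀ t ∈ Icc (0 : ℝ) 1, γ t ∈ Metric.ball u₀ r := by
    intro t ht
    simp only [γ, Metric.mem_ball, dist_eq_norm, add_sub_cancel_left, norm_smul] at hu ⊢
    calc ‖t‖ * ‖u - u₀‖ ≤ 1 * ‖u - u₀‖ := by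
          gcongr; rw [Real.norm_eq_abs, abs_le]; constructor <;> linarith [ht.1, ht.2]
      _ < r := by simpa using hu
  have hγd : ∀ t, HasDerivAt γ (u - u₀) t := fun t ↦ by
    simpa [γ] using ((hasDerivAt_id t).smul_const (u - u₀)).const_add u₀
  have hd : ∀ t ∈ Icc (0 : ℝ) 1,
      HasDerivAt (fun t ↦ π (g (γ t))) (π (fderiv ℝ g (γ t) (u - u₀))) t := fun t ht ↦
    π.hasFDerivAt.comp_hasDerivAt t
      ((hball _ (hγ t ht)).2.1.hasFDerivAt.comp_hasDerivAt t (hγd t))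
  -- Gronwall along the segment from `u₀` to `u`: the velocity of `g ∘ γ` is some `T (g (γ t)) w` of
  -- norm at most `C * ‖u - u₀‖`, so `hbound` is a linear differential inequality with zero initial
  -- value.
  have hzero := eq_zero_of_abs_deriv_le_mul_abs_self_of_eq_zero_right
    (f := fun t ↦ π (g (γ t))) (f' := fun t ↦ π (fderiv ℝ g (γ t) (u - u₀)))
    (K := 2 * K * (C * ‖u - u₀‖)) (a := 0) (b := 1)
    (fun t ht ↦ (hd t ht).continuousAt.continuousWithinAt)
    (fun t ht ↦ (hd t (Ico_subset_Icc_self ht)).hasDerivWithinAt)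
    (by simpa [γ] using (hπW _).2 h0)
    (fun t ht ↦ by
      obtain ⟨hb, -, hC', hr'⟩ := hball _ (hγ t (Ico_subset_Icc_self ht))
      obtain ⟨w, hw⟩ := hr' (u - u₀)
      calc ‖π (fderiv ℝ g (γ t) (u - u₀))‖
          ≤ 2 * K * ‖π (g (γ t))‖ * ‖fderiv ℝ g (γ t) (u - u₀)‖ := by rw [← hw]; exact hb w
        _ ≤ 2 * K * ‖π (g (γ t))‖ * (C * ‖u - u₀‖) := by
            gcongr
            exact (ContinuousLinearMap.le_opNorm _ _).trans (by gcongr)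
        _ = _ := by ring)
    1 (by simp)
  simpa [γ] using (hπW _).1 hzero

end Flat

/-! ### Vector fields read in charts. -/

section Charts

variable {m : ℕ} {M : Type u} [TopologicalSpace M] [ChartedSpace (EuclideanSpace ℝ (Fin m)) M]
  {Φ : OpenPartialHomeomorph M (EuclideanSpace ℝ (Fin m))} {x : M}

/-- The differential of a chart, with values in the model space. -/
noncomputable def coordDeriv (Φ : OpenPartialHomeomorph M (EuclideanSpace ℝ (Fin m))) (x : M) :
    TangentSpace (𝓡 m) x →L[ℝ] EuclideanSpace ℝ (Fin m) :=
  mfderiv (𝓡 m) (𝓡 m) Φ x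

/-- The differential of the inverse of a chart. -/
noncomputable def coordDerivSymm (Φ : OpenPartialHomeomorph M (EuclideanSpace ℝ (Fin m)))
    (z : EuclideanSpace ℝ (Fin m)) : EuclideanSpace ℝ (Fin m) →L[ℝ] TangentSpace (𝓡 m) (Φ.symm z) :=
  mfderiv (𝓡 m) (𝓡 m) Φ.symm z

lemma mdifferentiable_of_mem_maximalAtlas (hΦ : Φ ∈ IsManifold.maximalAtlas (𝓡 m) ∞ M) :
    Φ.MDifferentiable (𝓡 m) (𝓡 m) :=
  ⟨(contMDiffOn_of_mem_maximalAtlas hΦ).mdifferentiableOn (by simp),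
    (contMDiffOn_symm_of_mem_maximalAtlas hΦ).mdifferentiableOn (by simp)⟩

lemma coordDeriv_injective [IsManifold (𝓡 m) ∞ M] (hΦ : Φ ∈ IsManifold.maximalAtlas (𝓡 m) ∞ M)
    (hx : x ∈ Φ.source) : Function.Injective (coordDeriv Φ x) :=
  (mdifferentiable_of_mem_maximalAtlas hΦ).mfderiv_injective hx

lemma coordDeriv_surjective [IsManifold (𝓡 m) ∞ M] (hΦ : Φ ∈ IsManifold.maximalAtlas (𝓡 m) ∞ M)
    (hx : x ∈ Φ.source) : Function.Surjective (coordDeriv Φ x) :=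
  (mdifferentiable_of_mem_maximalAtlas hΦ).mfderiv_surjective hx

lemma coordDeriv_coordDerivSymm (hΦ : Φ ∈ IsManifold.maximalAtlas (𝓡 m) ∞ M)
    {z : EuclideanSpace ℝ (Fin m)} (hz : z ∈ Φ.target) (w : EuclideanSpace ℝ (Fin m)) :
    coordDeriv Φ (Φ.symm z) (coordDerivSymm Φ z w) = w :=
  DFunLike.congr_fun ((mdifferentiable_of_mem_maximalAtlas hΦ).comp_symm_deriv hz) w

/-- A smooth vector field is smooth in coordinates. -/
lemma contDiffAt_coordDeriv_field [IsManifold (𝓡 m) ∞ M]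
    (hΦ : Φ ∈ IsManifold.maximalAtlas (𝓡 m) ∞ M)
    (hx : x ∈ Φ.source) {X : ∀ y : M, TangentSpace (𝓡 m) y}
    (hX : ContMDiffAt (𝓡 m) (𝓡 m).tangent ∞ (fun y ↦ (⟨y, X y⟩ : TangentBundle (𝓡 m) M)) x) :
    ContDiffAt ℝ ∞ (fun z ↦ coordDeriv Φ (Φ.symm z) (X (Φ.symm z))) (Φ x) := by
  have hd := mdifferentiable_of_mem_maximalAtlas hΦ
  -- Pullback of fields is defined with the inverse of the differential of `Φ.symm`, which has to be
  -- recognised as the differential of `Φ`.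
  have hinv : ∀ z ∈ Φ.target, (mfderiv (𝓡 m) (𝓡 m) Φ.symm z).inverse =
      mfderiv (𝓡 m) (𝓡 m) Φ (Φ.symm z) := fun z hz ↦
    ContinuousLinearMap.inverse_eq (by
      have := hd.symm_comp_deriv (Φ.map_target hz)
      rwa [Φ.right_inv hz] at this) (hd.comp_symm_deriv hz)
  have hX' : ContMDiffAt (𝓡 m) (𝓡 m).tangent ∞ (fun y ↦ (⟨y, X y⟩ : TangentBundle (𝓡 m) M))
      (Φ.symm (Φ x)) := by rwa [Φ.left_inv hx]
  have : IsManifold (𝓡 m) (∞ + 1) M := by simpa using ‹IsManifold (𝓡 m) ∞ M›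
  have := ContMDiffAt.mpullback_vectorField_preimage (n := ∞) (m := ∞) hX'
    (contMDiffAt_symm_of_mem_maximalAtlas hΦ (Φ.map_source hx))
    ⟨hd.symm.mfderiv (Φ.map_source hx), rfl⟩ (by simp)
  have h2 := (contMDiff_snd_tangentBundle_modelSpace (EuclideanSpace ℝ (Fin m)) (𝓡 m)
    (n := ∞)).contMDiffAt.comp _ this
  refine (contMDiffAt_iff_contDiffAt.1 h2).congr_of_eventuallyEq ?_
  filter_upwards [Φ.open_target.mem_nhds (Φ.map_source hx)] with z hz
  exact (DFunLike.congr_fun (hinv z hz) (X (Φ.symm z))).symm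

/-- A smooth field of coordinate vectors defines a smooth vector field. -/
lemma exists_field_of_coordDeriv [IsManifold (𝓡 m) ∞ M]
    (hΦ : Φ ∈ IsManifold.maximalAtlas (𝓡 m) ∞ M)
    (Z : EuclideanSpace ℝ (Fin m) → EuclideanSpace ℝ (Fin m)) :
    ∃ X : ∀ y : M, TangentSpace (𝓡 m) y,
      (∀ x ∈ Φ.source, ContDiffAt ℝ ∞ Z (Φ x) →
        ContMDiffAt (𝓡 m) (𝓡 m).tangent ∞ (fun y ↦ (⟨y, X y⟩ : TangentBundle (𝓡 m) M)) x) ∧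
      ∀ y ∈ Φ.source, coordDeriv Φ y (X y) = Z (Φ y) := by
  have hd := mdifferentiable_of_mem_maximalAtlas hΦ
  have : IsManifold (𝓡 m) (∞ + 1) M := by simpa using ‹IsManifold (𝓡 m) ∞ M›
  refine ⟨VectorField.mpullback (𝓡 m) (𝓡 m) Φ Z,
    fun x hx hZ ↦ ContMDiffAt.mpullback_vectorField_preimage (n := ∞) (m := ∞) ?_
      (contMDiffAt_of_mem_maximalAtlas hΦ hx) ⟨hd.mfderiv hx, rfl⟩ (by simp), fun y hy ↦ ?_⟩
  · rw [← contMDiffWithinAt_univ]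
    exact contMDiffWithinAt_vectorSpace_iff_contDiffWithinAt.2 hZ.contDiffWithinAt
  · have h1 : (mfderiv (𝓡 m) (𝓡 m) Φ y).inverse = mfderiv (𝓡 m) (𝓡 m) Φ.symm (Φ y) :=
      ContinuousLinearMap.inverse_eq (by
        have := hd.comp_symm_deriv (Φ.map_source hy)
        rwa [Φ.left_inv hy] at this) (hd.symm_comp_deriv hy)
    have h2 := hd.comp_symm_deriv (Φ.map_source hy)
    rw [Φ.left_inv hy] at h2
    exact (congrArg (coordDeriv Φ y) (DFunLike.congr_fun h1 (Z (Φ y)))).trans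
      (DFunLike.congr_fun h2 (Z (Φ y)))

end Charts

/-! ### Integral slices and their local uniqueness. -/

section Slices

variable {m : ℕ} {M : Type u} [TopologicalSpace M] [ChartedSpace (EuclideanSpace ℝ (Fin m)) M]
  {Δ : Set (TangentBundle (𝓡 m) M)}
  {Φ Φ' : OpenPartialHomeomorph M (EuclideanSpace ℝ (Fin m))}
  {W W' : Submodule ℝ (EuclideanSpace ℝ (Fin m))} {x : M}

/-- The part of the domain of the chart `Φ` that `Φ` maps to the linear subspace `W`. -/
def slice (Φ : OpenPartialHomeomorph M (EuclideanSpace ℝ (Fin m)))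
    (W : Submodule ℝ (EuclideanSpace ℝ (Fin m))) : Set M :=
  {x | x ∈ Φ.source ∧ Φ x ∈ W}

/-- The slice of a smooth chart `Φ` over `W` is tangent to `Δ`. -/
structure IsIntegralSlice (Δ : Set (TangentBundle (𝓡 m) M))
    (Φ : OpenPartialHomeomorph M (EuclideanSpace ℝ (Fin m)))
    (W : Submodule ℝ (EuclideanSpace ℝ (Fin m))) : Prop where
  mem_maximalAtlas : Φ ∈ IsManifold.maximalAtlas (𝓡 m) ∞ M
  mem_fiber_iff : ∀ x ∈ slice Φ W, ∀ v, v ∈ fiber Δ x ↔ coordDeriv Φ x v ∈ W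

/-- The dimension of the fibre of `Δ` at a point. -/
noncomputable def rank (Δ : Set (TangentBundle (𝓡 m) M)) (x : M) : ℕ :=
  Module.finrank ℝ (Submodule.span ℝ (fiber Δ x))

variable [IsManifold (𝓡 m) ∞ M]

/-- The differential of the chart is an isomorphism taking the fibre to `W`. Hence the rank is
constant along a slice, and any two slices through a point have the same dimension. -/
lemma IsIntegralSlice.rank_eq (h : IsIntegralSlice Δ Φ W) (hx : x ∈ slice Φ W) :
    rank Δ x = Module.finrank ℝ W := by
  have h1 : fiber Δ x = (W.comap (coordDeriv Φ x).toLinearMap : Set (TangentSpace (𝓡 m) x)) := by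
    ext v; exact h.mem_fiber_iff x hx v
  rw [rank, h1, Submodule.span_eq]
  have h2 := (Submodule.equivMapOfInjective (coordDeriv Φ x).toLinearMap
    (coordDeriv_injective h.mem_maximalAtlas hx.1)
    (W.comap (coordDeriv Φ x).toLinearMap)).finrank_eq
  rw [h2, Submodule.map_comap_eq_of_surjective]
  exact coordDeriv_surjective h.mem_maximalAtlas hx.1

/-- Near a point of an integral slice, there is a smooth family of vectors in `Δ` that is
parametrized linearly by `W` and is the identity at the point. -/
lemma IsIntegralSlice.exists_frame (hΔ : IsSingularDistribution Δ) (h : IsIntegralSlice Δ Φ W)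
    (hx : x ∈ slice Φ W) :
    ∃ T : EuclideanSpace ℝ (Fin m) → W →L[ℝ] EuclideanSpace ℝ (Fin m),
      ContDiffAt ℝ 1 T (Φ x) ∧ T (Φ x) = W.subtypeL ∧
      ∀ᶠ z in 𝓝 (Φ x), ∀ w, ∃ v ∈ fiber Δ (Φ.symm z), coordDeriv Φ (Φ.symm z) v = T z w := by
  classical
  let b := Module.finBasis ℝ W
  choose v hv using fun i ↦
    coordDeriv_surjective h.mem_maximalAtlas hx.1 (b i : EuclideanSpace ℝ (Fin m))
  have hvΔ : ∀ i, v i ∈ fiber Δ x := fun i ↦ (h.mem_fiber_iff x hx _).2 (by rw [hv]; exact (b i).2)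
  choose U X hU hxU hX hXx hXΔ using fun i ↦ hΔ.smooth x (v i) (hvΔ i)
  let Y : _ → EuclideanSpace ℝ (Fin m) → EuclideanSpace ℝ (Fin m) :=
    fun i z ↦ coordDeriv Φ (Φ.symm z) (X i (Φ.symm z))
  have hY : ∀ i, ContDiffAt ℝ ∞ (Y i) (Φ x) := fun i ↦
    contDiffAt_coordDeriv_field h.mem_maximalAtlas hx.1
      ((hX i).contMDiffAt ((hU i).mem_nhds (hxU i)))
  -- A basis of `W` is lifted to vectors of `Δ` at `x` and extended to fields tangent to `Δ`. Off
  -- the slice the rank may be larger, so these fields need not span `Δ` there.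
  let T : EuclideanSpace ℝ (Fin m) → W →L[ℝ] EuclideanSpace ℝ (Fin m) := fun z ↦
    ∑ i, (b.coord i).toContinuousLinearMap.smulRight (Y i z)
  have hTapp : ∀ z w, T z w = ∑ i, b.repr w i • Y i z := fun z w ↦ by
    simp [T]
  refine ⟨T, ?_, ?_, ?_⟩
  · refine ContDiffAt.sum fun i _ ↦ ?_
    exact contDiffAt_const.smulRight ((hY i).of_le (by exact_mod_cast le_top))
  · ext1 w
    have hYx : ∀ i, Y i (Φ x) = b i := fun i ↦ by
      simp only [Y]
      rw [Φ.left_inv hx.1, hXx, hv]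
    rw [hTapp]
    simp only [hYx]
    have := congrArg W.subtype (b.sum_repr w)
    rw [map_sum] at this
    exact this
  · have hmem : ∀ᶠ z in 𝓝 (Φ x), ∀ i, Φ.symm z ∈ U i := by
      refine eventually_all.2 fun i ↦ ?_
      have := Φ.continuousAt_symm (Φ.map_source hx.1)
      rw [ContinuousAt, Φ.left_inv hx.1] at this
      exact this.eventually ((hU i).mem_nhds (hxU i))
    filter_upwards [hmem] with z hz w
    obtain ⟨V, hV⟩ := hΔ.subspace (Φ.symm z)
    refine ⟨∑ i, b.repr w i • X i (Φ.symm z), ?_, ?_⟩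
    · rw [← hV]
      refine V.sum_mem fun i _ ↦ V.smul_mem _ ?_
      have := hXΔ i _ (hz i)
      rwa [← hV] at this
    · rw [hTapp, map_sum]
      simp [Y]

/-- Local uniqueness of slices. The first slice, read in the second chart, is a map `g` on `W` whose
velocities lie in the image of `Δ`. Along it the rank keeps the value `finrank W'`, so the frame of
the second slice spans this image, and the Gronwall criterion keeps `g` in `W'`. -/
lemma IsIntegralSlice.slice_mem_nhdsWithin (hΔ : IsSingularDistribution Δ)
    (h : IsIntegralSlice Δ Φ W) (h' : IsIntegralSlice Δ Φ' W') (hx : x ∈ slice Φ W) (hx' : x ∈ slice Φ' W') :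
    slice Φ' W' ∈ 𝓝[slice Φ W] x := by
  obtain ⟨T, hT, hT0, hTv⟩ := h'.exists_frame hΔ hx'
  have hd := mdifferentiable_of_mem_maximalAtlas h.mem_maximalAtlas
  have hd' := mdifferentiable_of_mem_maximalAtlas h'.mem_maximalAtlas
  have htx : Φ x ∈ Φ.target := Φ.map_source hx.1
  let u₀ : W := ⟨Φ x, hx.2⟩
  let g : W → EuclideanSpace ℝ (Fin m) := fun u ↦ Φ' (Φ.symm u)
  have hg0 : g u₀ = Φ' x := by simp [g, u₀, Φ.left_inv hx.1]
  have hxs : ContinuousAt Φ.symm (Φ x) := Φ.continuousAt_symm htx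
  have hxs' : Tendsto Φ.symm (𝓝 (Φ x)) (𝓝 x) := by
    rwa [ContinuousAt, Φ.left_inv hx.1] at hxs
  have hcoe : Tendsto (fun u : W ↦ (u : EuclideanSpace ℝ (Fin m))) (𝓝 u₀) (𝓝 (Φ x)) :=
    continuous_subtype_val.tendsto u₀
  have hG : ContDiffAt ℝ ∞ (fun z ↦ Φ' (Φ.symm z)) (Φ x) := by
    rw [← contMDiffAt_iff_contDiffAt]
    refine ContMDiffAt.comp (I' := 𝓡 m) (Φ x) ?_
      (contMDiffAt_symm_of_mem_maximalAtlas h.mem_maximalAtlas htx)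
    rw [Φ.left_inv hx.1]
    exact contMDiffAt_of_mem_maximalAtlas h'.mem_maximalAtlas hx'.1
  have hg : ContDiffAt ℝ ∞ g u₀ :=
    ContDiffAt.comp (g := fun z ↦ Φ' (Φ.symm z)) (f := W.subtypeL) u₀ hG
    W.subtypeL.contDiff.contDiffAt
  have hder : ∀ᶠ u : W in 𝓝 u₀, (u : EuclideanSpace ℝ (Fin m)) ∈ Φ.target ∧
      Φ.symm u ∈ slice Φ W ∧ Φ.symm (u : EuclideanSpace ℝ (Fin m)) ∈ Φ'.source ∧
      ∀ k : W, fderiv ℝ g u k =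
        coordDeriv Φ' (Φ.symm u) (coordDerivSymm Φ (u : EuclideanSpace ℝ (Fin m)) k) := by
    filter_upwards [hcoe.eventually (Φ.open_target.mem_nhds htx),
      (hxs'.comp hcoe).eventually (Φ'.open_source.mem_nhds hx'.1)] with u hu hu'
    refine ⟨hu, ⟨Φ.map_target hu, by rw [Φ.right_inv hu]; exact u.2⟩, hu', fun k ↦ ?_⟩
    have h1 : HasMFDerivAt (𝓡 m) (𝓡 m) (Φ' ∘ Φ.symm) (u : EuclideanSpace ℝ (Fin m))
        ((mfderiv (𝓡 m) (𝓡 m) Φ' (Φ.symm u)).comp (mfderiv (𝓡 m) (𝓡 m) Φ.symm u)) :=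
      HasMFDerivAt.comp (I' := 𝓡 m) (u : EuclideanSpace ℝ (Fin m))
        (hd'.mdifferentiableAt hu').hasMFDerivAt
        (hd.mdifferentiableAt_symm hu).hasMFDerivAt
    have h2 := h1.hasFDerivAt.comp u W.subtypeL.hasFDerivAt
    exact DFunLike.congr_fun h2.fderiv k
  have hrank : rank Δ x = Module.finrank ℝ W' := h'.rank_eq hx'
  have hWW : Module.finrank ℝ W = Module.finrank ℝ W' := (h.rank_eq hx).symm.trans hrank
  have hnear : ∀ᶠ z in 𝓝 (Φ' x), ‖T z - W'.subtypeL‖ ≤ 1 / 2 := by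
    have := hT.continuousAt.tendsto
    rw [hT0] at this
    have := this.eventually (Metric.closedBall_mem_nhds _ (by norm_num : (0 : ℝ) < 1 / 2))
    simpa [dist_eq_norm] using this
  have key : ∀ᶠ u in 𝓝 u₀, g u ∈ W' := by
    refine eventually_mem_of_fderiv_mem_range (T := T) (by rwa [hg0])
      (hg.of_le (by exact_mod_cast le_top))
      (by rw [hg0]; exact hx'.2) (by rw [hg0, hT0]) ?_ ?_
    -- On the second slice the frame takes values in `Δ`, which is the direction `W'` there.
    · rw [hg0]
      filter_upwards [hTv, Φ'.open_target.mem_nhds (Φ'.map_source hx'.1)] with z hz hzt hzW w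
      obtain ⟨v, hv, hvT⟩ := hz w
      rw [← hvT]
      exact (h'.mem_fiber_iff _ ⟨Φ'.map_target hzt, by rwa [Φ'.right_inv hzt]⟩ v).1 hv
    · have hgt : Tendsto g (𝓝 u₀) (𝓝 (Φ' x)) := hg0 ▸ hg.continuousAt.tendsto
      filter_upwards [hder, hgt.eventually hTv, hgt.eventually hnear]
        with u ⟨hut, hus, hus', hu⟩ huT hun k
      have hgu : Φ'.symm (g u) = Φ.symm (u : EuclideanSpace ℝ (Fin m)) := Φ'.left_inv hus'
      rw [hgu] at huT
      set y := Φ.symm (u : EuclideanSpace ℝ (Fin m))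
      -- `D` is `Δ` at `y` read in the second chart. It contains the range of the injective map `T
      -- (g u)`, and equality follows by comparing dimensions.
      let D : Submodule ℝ (EuclideanSpace ℝ (Fin m)) :=
        (Submodule.span ℝ (fiber Δ y)).map (coordDeriv Φ' y).toLinearMap
      have hDrank : Module.finrank ℝ D = Module.finrank ℝ W' := by
        rw [← hWW, ← h.rank_eq hus]
        exact (Submodule.equivMapOfInjective (coordDeriv Φ' y).toLinearMap
          (coordDeriv_injective h'.mem_maximalAtlas hus') _).finrank_eq.symm
      have hinj : Function.Injective (T (g u)) := by
        refine (injective_iff_map_eq_zero _).2 fun w hw ↦ ?_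
        have := norm_le_two_mul_of_norm_sub_subtypeL_le hun w
        rw [hw, norm_zero, mul_zero] at this
        exact norm_le_zero_iff.1 this
      have hle : LinearMap.range (T (g u)).toLinearMap ≤ D := by
        rintro _ ⟨w, rfl⟩
        obtain ⟨v, hv, hvT⟩ := huT w
        exact ⟨v, Submodule.subset_span hv, hvT⟩
      have heq : LinearMap.range (T (g u)).toLinearMap = D := by
        refine Submodule.eq_of_le_of_finrank_eq hle ?_
        rw [hDrank, LinearMap.finrank_range_of_inj hinj]
      have hkD : fderiv ℝ g u k ∈ D := by
        rw [hu]
        refine ⟨_, Submodule.subset_span ((h.mem_fiber_iff y hus _).2 ?_), rfl⟩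
        rw [coordDeriv_coordDerivSymm h.mem_maximalAtlas hut]
        exact k.2
      rw [← heq] at hkD
      exact hkD
  have key' : ∀ᶠ z in 𝓝[(W : Set (EuclideanSpace ℝ (Fin m)))] (Φ x), Φ' (Φ.symm z) ∈ W' :=
    preimage_coe_mem_nhds_subtype (a := u₀).1 key
  have htend : Tendsto Φ (𝓝[slice Φ W] x) (𝓝[(W : Set (EuclideanSpace ℝ (Fin m)))] (Φ x)) :=
    tendsto_nhdsWithin_iff.2 ⟨(Φ.continuousAt hx.1).mono_left nhdsWithin_le_nhds,
      eventually_mem_nhdsWithin.mono fun y hy ↦ hy.2⟩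
  filter_upwards [htend.eventually key', self_mem_nhdsWithin,
    nhdsWithin_le_nhds (Φ'.open_source.mem_nhds hx'.1)] with y hy hyS hy'
  rw [Φ.left_inv hyS.1] at hy
  exact ⟨hy', hy⟩

end Slices

/-! ### The leaf topology. -/

section LeafSpace

variable {m : ℕ} {M : Type u} [TopologicalSpace M] [ChartedSpace (EuclideanSpace ℝ (Fin m)) M]

/-- The manifold `M`, to be equipped with the leaf topology of `Δ`. -/
def LeafSpace (_Δ : Set (TangentBundle (𝓡 m) M)) : Type u := M

/-- The identity map from `M` to `M` with the leaf topology. -/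
def leafEquiv (Δ : Set (TangentBundle (𝓡 m) M)) : M ≃ LeafSpace Δ := Equiv.refl M

variable {Δ : Set (TangentBundle (𝓡 m) M)}
  {Φ : OpenPartialHomeomorph M (EuclideanSpace ℝ (Fin m))}
  {W : Submodule ℝ (EuclideanSpace ℝ (Fin m))} {x : M}

/-- The leaf topology: a set is open if its trace on each integral slice is open in the slice. -/
instance : TopologicalSpace (LeafSpace Δ) where
  IsOpen V := ∀ x, leafEquiv Δ x ∈ V → ∀ Φ W, IsIntegralSlice Δ Φ W → x ∈ slice Φ W →
    leafEquiv Δ ⁻¹' V ∈ 𝓝[slice Φ W] x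
  isOpen_univ := by simp
  isOpen_inter V V' hV hV' x hx Φ W hΦ hxΦ :=
    inter_mem (hV x hx.1 Φ W hΦ hxΦ) (hV' x hx.2 Φ W hΦ hxΦ)
  isOpen_sUnion s hs x := by
    rintro ⟨V, hVs, hxV⟩ Φ W hΦ hxΦ
    exact mem_of_superset (hs V hVs x hxV Φ W hΦ hxΦ) fun y hy ↦ ⟨V, hVs, hy⟩

lemma isOpen_leafSpace_iff {V : Set (LeafSpace Δ)} :
    IsOpen V ↔ ∀ x, leafEquiv Δ x ∈ V → ∀ Φ W, IsIntegralSlice Δ Φ W → x ∈ slice Φ W →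
      leafEquiv Δ ⁻¹' V ∈ 𝓝[slice Φ W] x :=
  Iff.rfl

lemma IsIntegralSlice.exists_restr (h : IsIntegralSlice Δ Φ W) {U : Set M} (hU : IsOpen U) :
    ∃ Φ' : OpenPartialHomeomorph M (EuclideanSpace ℝ (Fin m)),
      IsIntegralSlice Δ Φ' W ∧ slice Φ' W = slice Φ W ∩ U := by
  have hs : slice (Φ.restr U) W = slice Φ W ∩ U := by
    ext y
    simp only [slice, OpenPartialHomeomorph.restr_source, hU.interior_eq, mem_inter_iff,
      mem_ofPred_eq, OpenPartialHomeomorph.restr_apply]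
    tauto
  refine ⟨Φ.restr U, ⟨restr_mem_maximalAtlas _ h.mem_maximalAtlas hU, fun y hy v ↦ ?_⟩, hs⟩
  rw [hs] at hy
  exact h.mem_fiber_iff y hy.1 v

lemma IsIntegralSlice.exists_subset (h : IsIntegralSlice Δ Φ W) (hx : x ∈ slice Φ W)
    {V : Set (LeafSpace Δ)} (hV : IsOpen V) (hxV : leafEquiv Δ x ∈ V) :
    ∃ Φ' : OpenPartialHomeomorph M (EuclideanSpace ℝ (Fin m)),
      IsIntegralSlice Δ Φ' W ∧ x ∈ slice Φ' W ∧ slice Φ' W ⊆ leafEquiv Δ ⁻¹' V := by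
  obtain ⟨U, hU, hxU, hUV⟩ := mem_nhdsWithin.1 (isOpen_leafSpace_iff.1 hV x hxV Φ W h hx)
  obtain ⟨Φ', h', hs⟩ := h.exists_restr hU
  exact ⟨Φ', h', hs ▸ ⟨hx, hxU⟩, by rw [hs, inter_comm]; exact hUV⟩

variable [IsManifold (𝓡 m) ∞ M]

/-- A single slice determines the neighbourhoods: by local uniqueness, an open piece of it is a
neighbourhood of each of its points within every other slice, hence leafwise open. -/
lemma IsIntegralSlice.nhds_leafEquiv (h : IsIntegralSlice Δ Φ W) (hΔ : IsSingularDistribution Δ)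
    (hx : x ∈ slice Φ W) :
    𝓝 (leafEquiv Δ x) = map (leafEquiv Δ) (𝓝[slice Φ W] x) := by
  ext V
  rw [mem_map]
  constructor
  · intro hV
    obtain ⟨V', hV', hV'o, hxV'⟩ := mem_nhds_iff.1 hV
    exact mem_of_superset (isOpen_leafSpace_iff.1 hV'o x hxV' Φ W h hx) (preimage_mono hV')
  · intro hV
    obtain ⟨U, hU, hxU, hUV⟩ := mem_nhdsWithin.1 hV
    refine mem_nhds_iff.2 ⟨(leafEquiv Δ).symm ⁻¹' (U ∩ slice Φ W), fun y hy ↦ ?_,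
      isOpen_leafSpace_iff.2 ?_, ?_⟩
    · exact hUV hy
    · intro y hy Φ' W' h' hy'
      simp only [← preimage_comp, Equiv.symm_comp_self, preimage_id, mem_preimage,
        Equiv.symm_apply_apply] at hy ⊢
      exact inter_mem (nhdsWithin_le_nhds (hU.mem_nhds hy.1))
        (h'.slice_mem_nhdsWithin hΔ h hy' hy.2)
    · exact ⟨hxU, hx⟩

lemma IsIntegralSlice.isOpen_preimage (h : IsIntegralSlice Δ Φ W)
    (hΔ : IsSingularDistribution Δ) : IsOpen ((leafEquiv Δ).symm ⁻¹' slice Φ W) := by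
  refine isOpen_leafSpace_iff.2 fun y hy Φ' W' h' hy' ↦ ?_
  simp only [← preimage_comp, Equiv.symm_comp_self, preimage_id, mem_preimage,
        Equiv.symm_apply_apply] at hy ⊢
  exact h'.slice_mem_nhdsWithin hΔ h hy' hy

/-- Every point lies in an integral slice. -/
def HasIntegralSlices (Δ : Set (TangentBundle (𝓡 m) M)) : Prop :=
  ∀ x, ∃ Φ W, IsIntegralSlice Δ Φ W ∧ x ∈ slice Φ W

lemma continuous_leafEquiv_symm (hΔ : IsSingularDistribution Δ) (hS : HasIntegralSlices Δ) :
    Continuous (leafEquiv Δ).symm := by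
  refine continuous_iff_continuousAt.2 fun y ↦ ?_
  obtain ⟨x, rfl⟩ := (leafEquiv Δ).surjective y
  obtain ⟨Φ, W, h, hx⟩ := hS x
  rw [ContinuousAt, h.nhds_leafEquiv hΔ hx, tendsto_map'_iff, Equiv.symm_comp_self,
    Equiv.symm_apply_apply]
  exact tendsto_id.mono_left nhdsWithin_le_nhds

lemma IsIntegralSlice.continuousWithinAt_symm (h : IsIntegralSlice Δ Φ W)
    (hΔ : IsSingularDistribution Δ) {z : EuclideanSpace ℝ (Fin m)} (hz : z ∈ Φ.target)
    (hzW : z ∈ W) :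
    ContinuousWithinAt (fun z ↦ leafEquiv Δ (Φ.symm z)) W z := by
  have hmem : ∀ z ∈ Φ.target, z ∈ W → Φ.symm z ∈ slice Φ W := fun z hz hzW ↦
    ⟨Φ.map_target hz, by rwa [Φ.right_inv hz]⟩
  rw [ContinuousWithinAt, h.nhds_leafEquiv hΔ (hmem z hz hzW)]
  refine tendsto_map.comp (tendsto_nhdsWithin_iff.2
    ⟨(Φ.continuousAt_symm hz).mono_left nhdsWithin_le_nhds, ?_⟩)
  filter_upwards [self_mem_nhdsWithin, nhdsWithin_le_nhds (Φ.open_target.mem_nhds hz)] with y hy hy'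
  exact hmem y hy' hy

/-- On one slice the leaf topology is the subspace topology, so slices inherit second countability
from `M`. -/
lemma IsIntegralSlice.isInducing_subtype (h : IsIntegralSlice Δ Φ W)
    (hΔ : IsSingularDistribution Δ) :
    IsInducing fun a : ((leafEquiv Δ).symm ⁻¹' slice Φ W : Set (LeafSpace Δ)) ↦
      (leafEquiv Δ).symm a := by
  refine isInducing_iff_nhds.2 fun a ↦ ?_
  have h1 := h.nhds_leafEquiv (x := (leafEquiv Δ).symm a) hΔ a.2
  rw [Equiv.apply_symm_apply, ← comap_equiv_symm, nhdsWithin, comap_inf, comap_principal] at h1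
  have h2 : Subtype.val ⁻¹' ((leafEquiv Δ).symm ⁻¹' slice Φ W) =
      (univ : Set ((leafEquiv Δ).symm ⁻¹' slice Φ W)) := Subtype.coe_preimage_self _
  rw [nhds_subtype, h1, comap_inf, comap_principal, h2, principal_univ, inf_top_eq, comap_comap]
  rfl

/-- After restricting the chart to the preimage of a ball, the slice is a continuous image of the
convex set `W ∩ ball`. -/
lemma IsIntegralSlice.exists_isPreconnected (h : IsIntegralSlice Δ Φ W)
    (hΔ : IsSingularDistribution Δ) (hx : x ∈ slice Φ W) :
    ∃ Φ' : OpenPartialHomeomorph M (EuclideanSpace ℝ (Fin m)),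
      IsIntegralSlice Δ Φ' W ∧ x ∈ slice Φ' W ∧
      IsPreconnected ((leafEquiv Δ).symm ⁻¹' slice Φ' W) := by
  obtain ⟨r, hr, hball⟩ := Metric.isOpen_iff.1 Φ.open_target (Φ x) (Φ.map_source hx.1)
  obtain ⟨Φ', h', hs⟩ := h.exists_restr
    (Φ.isOpen_inter_preimage (Metric.isOpen_ball (x := Φ x) (ε := r)))
  refine ⟨Φ', h', hs ▸ ⟨hx, hx.1, Metric.mem_ball_self hr⟩, ?_⟩
  have hconn : IsPreconnected ((fun z ↦ leafEquiv Δ (Φ.symm z)) '' (W ∩ Metric.ball (Φ x) r)) := by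
    refine (W.convex.inter (convex_ball _ _)).isPreconnected.image _ fun z hz ↦ ?_
    exact (h.continuousWithinAt_symm hΔ (hball hz.2) hz.1).mono inter_subset_left
  convert hconn
  rw [hs]
  ext y
  constructor
  · rintro ⟨hy, hy'⟩
    exact ⟨Φ ((leafEquiv Δ).symm y), ⟨hy.2, hy'.2⟩, by simp [Φ.left_inv hy.1]⟩
  · rintro ⟨z, ⟨hzW, hz⟩, rfl⟩
    have hzt := hball hz
    simp only [mem_preimage, Equiv.symm_apply_apply]
    exact ⟨⟨Φ.map_target hzt, by rwa [Φ.right_inv hzt]⟩, Φ.map_target hzt, by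
      rwa [mem_preimage, Φ.right_inv hzt]⟩

lemma isOpen_connectedComponent_leafSpace (hΔ : IsSingularDistribution Δ)
    (hS : HasIntegralSlices Δ) (y : LeafSpace Δ) : IsOpen (connectedComponent y) := by
  refine isOpen_iff_mem_nhds.2 fun y' hy' ↦ ?_
  rw [connectedComponent_eq hy']
  obtain ⟨Φ, W, h, hx⟩ := hS ((leafEquiv Δ).symm y')
  obtain ⟨Φ', h', hx', hc⟩ := h.exists_isPreconnected hΔ hx
  exact mem_of_superset ((h'.isOpen_preimage hΔ).mem_nhds hx') (hc.subset_connectedComponent hx')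

/-- The rank is constant on slices, hence locally constant for the leaf topology. -/
lemma rank_eq_of_isPreconnected (hΔ : IsSingularDistribution Δ) (hS : HasIntegralSlices Δ)
    {A : Set (LeafSpace Δ)} (hA : IsPreconnected A) {x y : M} (hx : leafEquiv Δ x ∈ A)
    (hy : leafEquiv Δ y ∈ A) : rank Δ x = rank Δ y := by
  have hloc : IsLocallyConstant fun z : LeafSpace Δ ↦ rank Δ ((leafEquiv Δ).symm z) := by
    refine (IsLocallyConstant.iff_eventually_eq _).2 fun z ↦ ?_
    obtain ⟨x, rfl⟩ := (leafEquiv Δ).surjective z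
    obtain ⟨Φ, W, h, hx⟩ := hS x
    rw [h.nhds_leafEquiv hΔ hx, eventually_map]
    filter_upwards [self_mem_nhdsWithin] with y hy
    simp [h.rank_eq hy, h.rank_eq hx]
  simpa using hloc.apply_eq_of_isPreconnected hA hx hy

end LeafSpace

/-! ### Integral submanifolds carry the leaf topology. -/

section Immersed

variable {m : ℕ} {M : Type u} [TopologicalSpace M] [ChartedSpace (EuclideanSpace ℝ (Fin m)) M]
  [IsManifold (𝓡 m) ∞ M]
  {Δ : Set (TangentBundle (𝓡 m) M)}

/-- The image of the differential of a map that reads as a linear map in charts. -/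
lemma mem_range_mfderiv_iff {d : ℕ} {P : Type*} [TopologicalSpace P]
    [ChartedSpace (EuclideanSpace ℝ (Fin d)) P] [IsManifold (𝓡 d) ∞ P]
    {f : P → M} {c : OpenPartialHomeomorph P (EuclideanSpace ℝ (Fin d))}
    {Φ : OpenPartialHomeomorph M (EuclideanSpace ℝ (Fin m))}
    (hc : c ∈ IsManifold.maximalAtlas (𝓡 d) ∞ P) (hΦ : Φ ∈ IsManifold.maximalAtlas (𝓡 m) ∞ M)
    {ι : EuclideanSpace ℝ (Fin d) →L[ℝ] EuclideanSpace ℝ (Fin m)} {y : P}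
    (hy : y ∈ c.source) (hfy : f y ∈ Φ.source) (hf : MDifferentiableAt (𝓡 d) (𝓡 m) f y)
    (h : Φ ∘ f =ᶠ[𝓝 y] ι ∘ c) (v : TangentSpace (𝓡 m) (f y)) :
    v ∈ range (mfderiv (𝓡 d) (𝓡 m) f y) ↔ coordDeriv Φ (f y) v ∈ LinearMap.range ι.toLinearMap := by
  have hd := mdifferentiable_of_mem_maximalAtlas hΦ
  have hdc := mdifferentiable_of_mem_maximalAtlas hc
  have h1 := HasMFDerivAt.comp y (hd.mdifferentiableAt hfy).hasMFDerivAt hf.hasMFDerivAt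
  have h2 := HasMFDerivAt.comp y ι.hasMFDerivAt (hdc.mdifferentiableAt hy).hasMFDerivAt
  have h3 : ∀ w : TangentSpace (𝓡 d) y,
      coordDeriv Φ (f y) (mfderiv (𝓡 d) (𝓡 m) f y w) = ι (coordDeriv c y w) := fun w ↦
    DFunLike.congr_fun (hasMFDerivAt_unique (h1.congr_of_eventuallyEq h.symm) h2) w
  constructor
  · rintro ⟨w, rfl⟩
    exact ⟨coordDeriv c y w, (h3 w).symm⟩
  · rintro ⟨u, hu⟩
    obtain ⟨w, rfl⟩ := coordDeriv_surjective hc hy u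
    exact ⟨w, coordDeriv_injective hΦ hfy ((h3 w).trans hu)⟩

/-- An integral submanifold is locally an integral slice. -/
lemma IsIntegral.exists_slice {L : ImmersedSubmanifold m M} (hL : IsIntegral Δ L)
    (y : Points L.carrier) :
    ∃ Φ W, IsIntegralSlice Δ Φ W ∧ incl L.carrier y ∈ slice Φ W ∧
      Module.finrank ℝ W = L.dim ∧
      map (incl L.carrier) (𝓝 y) = 𝓝[slice Φ W] (incl L.carrier y) := by
  set f := incl L.carrier
  obtain ⟨F, _, _, hF⟩ := L.isImmersion
  have h := hF y
  set c := h.domChart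
  set Φ₀ := h.codChart
  set eq := h.equiv
  have hcΦ : ∀ y' ∈ c.source, f y' ∈ Φ₀.source := fun y' hy' ↦ h.source_subset_preimage_source hy'
  have hwr : ∀ y' ∈ c.source, Φ₀ (f y') = eq (c y', 0) := fun y' hy' ↦ by
    have h1 : c y' ∈ (c.extend (𝓡 L.dim)).target := by
      simpa [mfld_simps] using c.map_source hy'
    have h2 := h.writtenInCharts h1
    have h3 : (c.extend (𝓡 L.dim)).symm (c y') = y' := by simp [mfld_simps, c.left_inv hy']
    simp only [Function.comp_apply] at h2
    rw [h3] at h2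
    simpa [mfld_simps] using h2
  let ι : EuclideanSpace ℝ (Fin L.dim) →L[ℝ] EuclideanSpace ℝ (Fin m) :=
    eq.toContinuousLinearMap.comp (ContinuousLinearMap.inl ℝ _ F)
  let ρ : EuclideanSpace ℝ (Fin m) → EuclideanSpace ℝ (Fin L.dim) := fun z ↦ (eq.symm z).1
  have hρc : Continuous ρ := continuous_fst.comp eq.symm.continuous
  have hρ : ∀ u, ρ (ι u) = u := fun u ↦ by simp [ρ, ι]
  -- The immersion reads as `ι` in the charts. The condition on `ρ` discards points over `W` whose
  -- parameter leaves `c.target`, so that the slice is exactly the image of `c.source`.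
  let U : Set M := Φ₀.source ∩ (ρ ∘ Φ₀) ⁻¹' c.target
  have hU : IsOpen U := (hρc.comp_continuousOn Φ₀.continuousOn).isOpen_inter_preimage
    Φ₀.open_source c.open_target
  let W := LinearMap.range ι.toLinearMap
  let Φ := Φ₀.restr U
  have hΦs : ∀ x', x' ∈ Φ.source ↔ x' ∈ U := fun x' ↦ by
    simp only [Φ, OpenPartialHomeomorph.restr_source, hU.interior_eq]
    exact ⟨fun h ↦ h.2, fun h ↦ ⟨h.1, h⟩⟩
  have hΦm : Φ ∈ IsManifold.maximalAtlas (𝓡 m) ∞ M :=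
    restr_mem_maximalAtlas _ h.codChart_mem_maximalAtlas hU
  have hcU : ∀ y' ∈ c.source, f y' ∈ U := fun y' hy' ↦ ⟨hcΦ y' hy', by
    change ρ (Φ₀ (f y')) ∈ c.target
    rw [hwr y' hy']
    exact (hρ (c y')).symm ▸ c.map_source hy'⟩
  have hslice : slice Φ W = f '' c.source := by
    ext x'
    constructor
    · rintro ⟨hx', u, hu⟩
      replace hx' := (hΦs x').1 hx'
      have hu' : Φ₀ x' = ι u := hu.symm
      have hut : u ∈ c.target := by
        have := hx'.2
        rwa [mem_preimage, Function.comp_apply, hu', hρ] at this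
      refine ⟨c.symm u, c.map_target hut, Φ₀.injOn (hcΦ _ (c.map_target hut)) hx'.1 ?_⟩
      rw [hwr _ (c.map_target hut), c.right_inv hut, hu']
      rfl
    · rintro ⟨y', hy', rfl⟩
      exact ⟨(hΦs _).2 (hcU y' hy'), c y', (hwr y' hy').symm⟩
  refine ⟨Φ, W, ⟨hΦm, ?_⟩, ?_, ?_, ?_⟩
  · intro x' hx' v
    rw [hslice] at hx'
    obtain ⟨y', hy', rfl⟩ := hx'
    rw [← hL y']
    refine mem_range_mfderiv_iff h.domChart_mem_maximalAtlas hΦm hy' ((hΦs _).2 (hcU y' hy'))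
      ((h.contMDiffOn.contMDiffAt (c.open_source.mem_nhds hy')).mdifferentiableAt (by simp)) ?_ v
    filter_upwards [c.open_source.mem_nhds hy'] with y'' hy''
    exact hwr y'' hy''
  · exact hslice ▸ mem_image_of_mem f h.mem_domChart_source
  · have hinj : Function.Injective ι := fun a b hab ↦ by rw [← hρ a, hab, hρ]
    exact (LinearMap.finrank_range_of_inj hinj).trans (by simp)
  · rw [hslice]
    refine le_antisymm (tendsto_nhdsWithin_iff.2 ⟨h.continuousAt, ?_⟩) ?_
    · filter_upwards [c.open_source.mem_nhds h.mem_domChart_source] with y' hy'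
      exact mem_image_of_mem f hy'
    · intro V hV
      -- This retraction, continuous at `f y` for the topology of `M`, inverts `f` on the slice;
      -- hence neighbourhoods within the slice are no coarser than those of `L`.
      have hr : Tendsto (fun x' ↦ c.symm (ρ (Φ₀ x'))) (𝓝 (f y)) (𝓝 y) := by
        have e1 : ρ (Φ₀ (f y)) = c y := by
          rw [hwr y h.mem_domChart_source]; exact hρ (c y)
        have e2 : ContinuousAt c.symm (ρ (Φ₀ (f y))) := by
          rw [e1]; exact c.continuousAt_symm (c.map_source h.mem_domChart_source)
        have e3 : ContinuousAt (fun x' ↦ ρ (Φ₀ x')) (f y) :=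
          hρc.continuousAt.comp (Φ₀.continuousAt (hcΦ y h.mem_domChart_source))
        have := ContinuousAt.comp (g := c.symm) (f := fun x' ↦ ρ (Φ₀ x')) e2 e3
        rw [ContinuousAt] at this
        simpa only [Function.comp_def, e1, c.left_inv h.mem_domChart_source] using this
      filter_upwards [nhdsWithin_le_nhds (hr.eventually hV), self_mem_nhdsWithin] with x' hx' hx''
      obtain ⟨y', hy', rfl⟩ := hx''
      have : c.symm (ρ (Φ₀ (f y'))) = y' := by
        rw [hwr y' hy']
        exact (congrArg c.symm (hρ (c y'))).trans (c.left_inv hy')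
      rwa [this] at hx'

lemma IsIntegrable.hasIntegralSlices (hΔ : IsIntegrable Δ) : HasIntegralSlices Δ := fun x ↦ by
  obtain ⟨L, hx, hL⟩ := hΔ.exists_integral x
  obtain ⟨Φ, W, h, hxΦ, -⟩ := hL.exists_slice ⟨x, hx⟩
  exact ⟨Φ, W, h, hxΦ⟩

/-- The manifold topology of an integral submanifold is the leaf topology. -/
lemma IsIntegral.isOpenEmbedding (hΔ : IsSingularDistribution Δ) {L : ImmersedSubmanifold m M}
    (hL : IsIntegral Δ L) : IsOpenEmbedding fun y ↦ leafEquiv Δ (incl L.carrier y) := by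
  have hmap : ∀ y, map (fun y ↦ leafEquiv Δ (incl L.carrier y)) (𝓝 y) =
      𝓝 (leafEquiv Δ (incl L.carrier y)) := fun y ↦ by
    obtain ⟨Φ, W, h, hx, -, hm⟩ := hL.exists_slice y
    rw [h.nhds_leafEquiv hΔ hx, ← hm, map_map]
    rfl
  exact .of_continuous_injective_isOpenMap
    (continuous_iff_continuousAt.2 fun y ↦ (hmap y).le)
    ((leafEquiv Δ).injective.comp Subtype.val_injective)
    (IsOpenMap.of_nhds_le fun y ↦ (hmap y).ge)

end Immersed

/-! ### Integral submanifolds from leafwise open sets. -/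

section Builder

/-- A subspace of dimension `d` is the image of a split linear injection. -/
lemma exists_split_injection {m d : ℕ} (W : Submodule ℝ (EuclideanSpace ℝ (Fin m)))
    (hW : Module.finrank ℝ W = d) :
    ∃ (ι : EuclideanSpace ℝ (Fin d) →L[ℝ] EuclideanSpace ℝ (Fin m))
      (ρ : EuclideanSpace ℝ (Fin m) →L[ℝ] EuclideanSpace ℝ (Fin d)),
      LinearMap.range ι.toLinearMap = W ∧ ∀ u, ρ (ι u) = u := by
  let e : EuclideanSpace ℝ (Fin d) ≃L[ℝ] W :=
    ContinuousLinearEquiv.ofFinrankEq (by simp [hW])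
  refine ⟨W.subtypeL.comp e.toContinuousLinearMap,
    e.symm.toContinuousLinearMap.comp W.orthogonalProjectionOnto, ?_, fun u ↦ ?_⟩
  · ext w
    constructor
    · rintro ⟨u, rfl⟩; exact (e u).2
    · intro hw; exact ⟨e.symm ⟨w, hw⟩, by simp⟩
  · simp

/-- A split linear injection is the first coordinate inclusion of a product decomposition. -/
lemma exists_prod_equiv {m d : ℕ} {ι : EuclideanSpace ℝ (Fin d) →L[ℝ] EuclideanSpace ℝ (Fin m)}
    {ρ : EuclideanSpace ℝ (Fin m) →L[ℝ] EuclideanSpace ℝ (Fin d)} (hρ : ∀ u, ρ (ι u) = u) :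
    ∃ e : (EuclideanSpace ℝ (Fin d) × EuclideanSpace ℝ (Fin (m - d))) ≃L[ℝ]
      EuclideanSpace ℝ (Fin m), ∀ u, e (u, 0) = ι u := by
  let e₁ := ContinuousLinearEquiv.equivOfRightInverse ρ ι hρ
  have hk : Module.finrank ℝ (LinearMap.ker ρ.toLinearMap) = m - d := by
    have h := e₁.toLinearEquiv.finrank_eq
    rw [Module.finrank_prod] at h
    simp only [finrank_euclideanSpace, Fintype.card_fin] at h
    exact (Nat.sub_eq_of_eq_add' h).symm
  let e₂ : EuclideanSpace ℝ (Fin (m - d)) ≃L[ℝ] LinearMap.ker ρ.toLinearMap :=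
    ContinuousLinearEquiv.ofFinrankEq (by simp [hk])
  refine ⟨((ContinuousLinearEquiv.refl ℝ _).prodCongr e₂).trans e₁.symm, fun u ↦ ?_⟩
  simp [e₁]

variable {m d : ℕ} {M : Type u} [TopologicalSpace M]

lemma symm_mem_slice_range {Φ : OpenPartialHomeomorph M (EuclideanSpace ℝ (Fin m))}
    {ι : EuclideanSpace ℝ (Fin d) →L[ℝ] EuclideanSpace ℝ (Fin m)} {u : EuclideanSpace ℝ (Fin d)}
    (hu : ι u ∈ Φ.target) : Φ.symm (ι u) ∈ slice Φ (LinearMap.range ι.toLinearMap) :=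
  ⟨Φ.map_target hu, by rw [Φ.right_inv hu]; exact ⟨u, rfl⟩⟩

variable [ChartedSpace (EuclideanSpace ℝ (Fin m)) M] [IsManifold (𝓡 m) ∞ M]
  {Δ : Set (TangentBundle (𝓡 m) M)}

open scoped Classical in
/-- The chart of a leafwise open set given by an integral slice. -/
noncomputable def sliceChart (hΔ : IsSingularDistribution Δ) (hS : HasIntegralSlices Δ)
    {A : Set (LeafSpace Δ)} (a₀ : A) (Φ : OpenPartialHomeomorph M (EuclideanSpace ℝ (Fin m)))
    (ι : EuclideanSpace ℝ (Fin d) →L[ℝ] EuclideanSpace ℝ (Fin m))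
    (ρ : EuclideanSpace ℝ (Fin m) →L[ℝ] EuclideanSpace ℝ (Fin d)) (hρ : ∀ u, ρ (ι u) = u)
    (h : IsIntegralSlice Δ Φ (LinearMap.range ι.toLinearMap))
    (hA : slice Φ (LinearMap.range ι.toLinearMap) ⊆ leafEquiv Δ ⁻¹' A) :
    OpenPartialHomeomorph A (EuclideanSpace ℝ (Fin d)) where
  toFun a := ρ (Φ ((leafEquiv Δ).symm a))
  -- Outside the target the value `a₀` is arbitrary.
  invFun u := if hu : ι u ∈ Φ.target then
    ⟨leafEquiv Δ (Φ.symm (ι u)), hA (symm_mem_slice_range hu)⟩ else a₀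
  source := {a | (leafEquiv Δ).symm a ∈ slice Φ (LinearMap.range ι.toLinearMap)}
  target := ι ⁻¹' Φ.target
  map_source' := by
    rintro a ⟨ha, u, hu⟩
    have h1 : ι (ρ (Φ ((leafEquiv Δ).symm a))) = Φ ((leafEquiv Δ).symm a) := by
      rw [← hu]
      exact congrArg ι (hρ u)
    rw [mem_preimage, h1]
    exact Φ.map_source ha
  map_target' u hu := by
    rw [dif_pos (mem_preimage.1 hu)]
    exact symm_mem_slice_range hu
  left_inv' := by
    rintro a ⟨ha, u, hu⟩
    have h1 : ι (ρ (Φ ((leafEquiv Δ).symm a))) = Φ ((leafEquiv Δ).symm a) := by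
      rw [← hu]
      exact congrArg ι (hρ u)
    have h2 : ι (ρ (Φ ((leafEquiv Δ).symm a))) ∈ Φ.target := by
      rw [h1]; exact Φ.map_source ha
    rw [dif_pos h2]
    apply Subtype.ext
    simp only [h1, Φ.left_inv ha, Equiv.apply_symm_apply]
  right_inv' u hu := by
    rw [dif_pos (mem_preimage.1 hu)]
    simp only [Equiv.symm_apply_apply]
    rw [Φ.right_inv hu, hρ]
  open_source := (h.isOpen_preimage hΔ).preimage continuous_subtype_val
  open_target := Φ.open_target.preimage ι.continuous
  continuousOn_toFun := by
    refine ρ.continuous.comp_continuousOn (Φ.continuousOn.comp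
      ((continuous_leafEquiv_symm hΔ hS).comp continuous_subtype_val).continuousOn ?_)
    exact fun a ha ↦ ha.1
  continuousOn_invFun := by
    rw [IsInducing.subtypeVal.continuousOn_iff]
    have h1 : ContinuousOn (fun u ↦ leafEquiv Δ (Φ.symm (ι u))) (ι ⁻¹' Φ.target) := fun u hu ↦
      (h.continuousWithinAt_symm hΔ hu ⟨u, rfl⟩).comp ι.continuous.continuousWithinAt
        fun u' _ ↦ ⟨u', rfl⟩
    refine h1.congr fun u hu ↦ ?_
    rw [Function.comp_apply, dif_pos (mem_preimage.1 hu)]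

/-- A second countable leafwise open set on which `Δ` has constant rank carries the structure of an
integral submanifold. -/
theorem exists_immersedSubmanifold [T2Space M] (hΔ : IsSingularDistribution Δ)
    (hS : HasIntegralSlices Δ) {A : Set (LeafSpace Δ)} (hA : IsOpen A)
    [SecondCountableTopology A] (hd : ∀ x, leafEquiv Δ x ∈ A → rank Δ x = d) :
    ∃ L : ImmersedSubmanifold m M, L.carrier = leafEquiv Δ ⁻¹' A ∧ IsIntegral Δ L := by
  have hex : ∀ a : A, ∃ (Φ : OpenPartialHomeomorph M (EuclideanSpace ℝ (Fin m)))
      (ι : EuclideanSpace ℝ (Fin d) →L[ℝ] EuclideanSpace ℝ (Fin m))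
      (ρ : EuclideanSpace ℝ (Fin m) →L[ℝ] EuclideanSpace ℝ (Fin d)),
      (∀ u, ρ (ι u) = u) ∧ IsIntegralSlice Δ Φ (LinearMap.range ι.toLinearMap) ∧
      slice Φ (LinearMap.range ι.toLinearMap) ⊆ leafEquiv Δ ⁻¹' A ∧
      (leafEquiv Δ).symm a ∈ slice Φ (LinearMap.range ι.toLinearMap) := fun a ↦ by
    obtain ⟨Φ₀, W, h₀, hx₀⟩ := hS ((leafEquiv Δ).symm a)
    obtain ⟨Φ, h, hx, hsub⟩ := h₀.exists_subset hx₀ hA (by simp)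
    obtain ⟨ι, ρ, rfl, hρ⟩ := exists_split_injection W
      ((h.rank_eq hx).symm.trans (hd _ (by simp)))
    exact ⟨Φ, ι, ρ, hρ, h, hsub, hx⟩
  choose Φ ι ρ hρ h hsub hx using hex
  let c : A → OpenPartialHomeomorph A (EuclideanSpace ℝ (Fin d)) := fun a ↦
    sliceChart hΔ hS a (Φ a) (ι a) (ρ a) (hρ a) (h a) (hsub a)
  let f : A → M := fun a ↦ (leafEquiv Δ).symm a
  have hf : Continuous f := (continuous_leafEquiv_symm hΔ hS).comp continuous_subtype_val
  have hfinj : Function.Injective f := (leafEquiv Δ).symm.injective.comp Subtype.val_injective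
  have hfc : ∀ a, ∀ u ∈ (c a).target, f ((c a).symm u) = (Φ a).symm (ι a u) := fun a u hu ↦ by
    have : (c a).symm u = ⟨leafEquiv Δ ((Φ a).symm (ι a u)), hsub a (symm_mem_slice_range hu)⟩ :=
      dif_pos hu
    rw [this]
    simp [f]
  let _ : ChartedSpace (EuclideanSpace ℝ (Fin d)) A :=
    { atlas := range c
      chartAt := c
      mem_chart_source := hx
      chart_mem_atlas := mem_range_self }
  have hman : IsManifold (𝓡 d) ∞ A := by
    refine isManifold_of_contDiffOn _ _ _ ?_
    rintro _ _ ⟨a, rfl⟩ ⟨b, rfl⟩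
    have hs : ∀ u, u ∈ ((c a).symm ≫ₕ c b).source ↔
        u ∈ (c a).target ∧ (c a).symm u ∈ (c b).source :=
      fun u ↦ by simp [mfld_simps]
    -- A transition map is the ambient transition map between the linear maps `ι a` and `ρ b`, hence
    -- smooth.
    have hsm : ContDiffOn ℝ ∞ (fun u ↦ ρ b (Φ b ((Φ a).symm (ι a u))))
        ((c a).symm ≫ₕ c b).source := by
      intro u hu
      obtain ⟨hu, hub⟩ := (hs u).1 hu
      have hub' : (Φ a).symm (ι a u) ∈ (Φ b).source := by rw [← hfc a u hu]; exact hub.1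
      rw [← contMDiffWithinAt_iff_contDiffWithinAt]
      refine ContMDiffAt.contMDiffWithinAt ?_
      refine (ρ b).contMDiff.contMDiffAt.comp u (ContMDiffAt.comp (I' := 𝓡 m) u
        (contMDiffAt_of_mem_maximalAtlas (h b).mem_maximalAtlas hub')
        (ContMDiffAt.comp (I' := 𝓡 m) u
          (contMDiffAt_symm_of_mem_maximalAtlas (h a).mem_maximalAtlas hu)
          (ι a).contMDiff.contMDiffAt))
    simp only [mfld_simps] at hsm ⊢
    refine hsm.congr fun u hu ↦ ?_
    exact congrArg (fun x ↦ ρ b (Φ b x)) (hfc a u hu.1)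
  have hcm : ∀ a, c a ∈ IsManifold.maximalAtlas (𝓡 d) ∞ A := fun a ↦
    IsManifold.subset_maximalAtlas ⟨a, rfl⟩
  have hfa : ∀ a, ∀ b ∈ (c a).source, Φ a (f b) = ι a (c a b) := fun a b hb ↦ by
    have := hfc a _ ((c a).map_source hb)
    rw [(c a).left_inv hb] at this
    rw [this, (Φ a).right_inv ((c a).map_source hb)]
  have himm : ∀ a, Manifold.IsImmersionAtOfComplement (EuclideanSpace ℝ (Fin (m - d)))
      (𝓡 d) (𝓡 m) ∞ f a := fun a ↦ by
    obtain ⟨e, he⟩ := exists_prod_equiv (hρ a)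
    refine .mk_of_continuousAt hf.continuousAt e (c a) (Φ a) (hx a) (hx a).1 (hcm a)
      (h a).mem_maximalAtlas fun u hu ↦ ?_
    have hu' : u ∈ (c a).target := by simpa [mfld_simps] using hu
    have h1 := hfc a u hu'
    simp only [mfld_simps, Function.comp_apply]
    rw [he, h1]
    exact (Φ a).right_inv hu'
  have hT2 : T2Space A := .of_injective_continuous hfinj hf
  let L : ImmersedSubmanifold m M :=
    { carrier := leafEquiv Δ ⁻¹' A
      dim := d
      topology := inferInstanceAs (TopologicalSpace A)
      charts := inferInstanceAs (ChartedSpace (EuclideanSpace ℝ (Fin d)) A)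
      isManifold := hman
      t2 := hT2
      secondCountable := inferInstanceAs (SecondCountableTopology A)
      isImmersion := ⟨_, _, _, himm⟩ }
  refine ⟨L, rfl, fun a ↦ ?_⟩
  ext v
  refine (mem_range_mfderiv_iff (hcm a) (h a).mem_maximalAtlas (hx a) (hx a).1
    ((himm a).contMDiffAt.mdifferentiableAt (by simp)) ?_ v).trans
    ((h a).mem_fiber_iff _ (hx a) v).symm
  filter_upwards [(c a).open_source.mem_nhds (hx a)] with b hb using hfa a b hb

end Builder

/-! ### Leaves as components of the leaf topology. -/

section Leaves

variable {m : ℕ} {M : Type u} [TopologicalSpace M] [ChartedSpace (EuclideanSpace ℝ (Fin m)) M]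
  {Δ : Set (TangentBundle (𝓡 m) M)}

lemma range_leafEquiv_incl (L : ImmersedSubmanifold m M) :
    range (fun y ↦ leafEquiv Δ (incl L.carrier y)) = (leafEquiv Δ).symm ⁻¹' L.carrier := by
  ext y
  constructor
  · rintro ⟨y, rfl⟩; exact y.2
  · intro hy; exact ⟨⟨_, hy⟩, rfl⟩

variable [IsManifold (𝓡 m) ∞ M]

lemma IsIntegral.isOpen_carrier (hΔ : IsSingularDistribution Δ) {L : ImmersedSubmanifold m M}
    (hL : IsIntegral Δ L) : IsOpen ((leafEquiv Δ).symm ⁻¹' L.carrier) := by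
  rw [← range_leafEquiv_incl]
  exact (hL.isOpenEmbedding hΔ).isOpen_range

lemma IsIntegral.connected_iff (hΔ : IsSingularDistribution Δ) {L : ImmersedSubmanifold m M}
    (hL : IsIntegral Δ L) :
    L.Connected ↔ IsConnected ((leafEquiv Δ).symm ⁻¹' L.carrier) := by
  rw [← range_leafEquiv_incl, ← image_univ, ImmersedSubmanifold.Connected,
    connectedSpace_iff_univ, IsConnected, IsConnected, image_nonempty,
    (hL.isOpenEmbedding hΔ).isInducing.isPreconnected_image]

variable [T2Space M] [SecondCountableTopology M]

/-- Every point lies in a connected integral submanifold. -/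
lemma exists_connected_integral (hΔ : IsSingularDistribution Δ) (hS : HasIntegralSlices Δ) (x : M) :
    ∃ L : ImmersedSubmanifold m M, x ∈ L.carrier ∧ IsIntegral Δ L ∧ L.Connected := by
  obtain ⟨Φ₀, W, h₀, hx₀⟩ := hS x
  obtain ⟨Φ, h, hx, hc⟩ := h₀.exists_isPreconnected hΔ hx₀
  have := (h.isInducing_subtype hΔ).secondCountableTopology
  obtain ⟨L, hL, hLi⟩ := exists_immersedSubmanifold hΔ hS (h.isOpen_preimage hΔ)
    (fun y hy ↦ h.rank_eq hy)
  refine ⟨L, by rw [hL]; exact hx, hLi, (hLi.connected_iff hΔ).2 ?_⟩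
  rw [hL]
  exact ⟨⟨leafEquiv Δ x, hx⟩, hc⟩

/-- The leaves are the second countable connected components of the leaf topology. -/
theorem mem_leaves_iff (hΔ : IsSingularDistribution Δ) (hS : HasIntegralSlices Δ) {A : Set M} :
    A ∈ leaves Δ ↔ ∃ x : M, A = leafEquiv Δ ⁻¹' connectedComponent (leafEquiv Δ x) ∧
      SecondCountableTopology (connectedComponent (leafEquiv Δ x)) := by
  constructor
  · rintro ⟨L, rfl, hL⟩
    have hconn := (hL.isIntegral.connected_iff hΔ).1 hL.connected
    obtain ⟨x, hx⟩ := hconn.nonempty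
    -- A connected integral submanifold through a point outside `L` cannot meet `L`, since
    -- maximality would absorb it. So the complement is open, and `L`, being connected and clopen,
    -- is a component.
    have hclosed : IsClosed ((leafEquiv Δ).symm ⁻¹' L.carrier) := by
      rw [← isOpen_compl_iff, isOpen_iff_mem_nhds]
      intro z hz
      obtain ⟨S, hzS, hS', hSc⟩ := exists_connected_integral hΔ hS ((leafEquiv Δ).symm z)
      refine mem_of_superset ((hS'.isOpen_carrier hΔ).mem_nhds hzS) fun y hy hyL ↦ hz ?_
      exact (hL.maximal S hS' hSc ⟨_, hy, hyL⟩).1 hzS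
    have heq : (leafEquiv Δ).symm ⁻¹' L.carrier = connectedComponent x :=
      (hconn.isPreconnected.subset_connectedComponent hx).antisymm
        (IsClopen.connectedComponent_subset ⟨hclosed, hL.isIntegral.isOpen_carrier hΔ⟩ hx)
    refine ⟨(leafEquiv Δ).symm x, ?_, ?_⟩
    · rw [Equiv.apply_symm_apply, ← heq]
      rfl
    · rw [Equiv.apply_symm_apply, ← heq, ← range_leafEquiv_incl]
      exact (hL.isIntegral.isOpenEmbedding hΔ).isEmbedding.toHomeomorph.symm.secondCountableTopology
  · rintro ⟨x, rfl, hx⟩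
    obtain ⟨L, hL, hLi⟩ := exists_immersedSubmanifold hΔ hS
      (isOpen_connectedComponent_leafSpace hΔ hS (leafEquiv Δ x)) (d := rank Δ x)
      (fun y hy ↦ rank_eq_of_isPreconnected hΔ hS isPreconnected_connectedComponent hy
        mem_connectedComponent)
    have hL' : (leafEquiv Δ).symm ⁻¹' L.carrier = connectedComponent (leafEquiv Δ x) := by
      rw [hL]; rfl
    refine ⟨L, hL, hLi, (hLi.connected_iff hΔ).2 (hL' ▸ isConnected_connectedComponent),
      fun S hS' hSc hSL ↦ ⟨?_, ?_⟩⟩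
    · obtain ⟨y, hyS, hyL⟩ := hSL
      have hyC : leafEquiv Δ y ∈ connectedComponent (leafEquiv Δ x) := hL' ▸ hyL
      have := ((hS'.connected_iff hΔ).1 hSc).isPreconnected.subset_connectedComponent
        (x := leafEquiv Δ y) hyS
      rw [← connectedComponent_eq hyC, ← hL'] at this
      exact this
    · exact (hS'.isOpen_carrier hΔ).preimage (hLi.isOpenEmbedding hΔ).continuous

end Leaves

/-! ### Pulling back slices and distributions along a submersion. -/

section Submersion

variable {m n : ℕ} {M : Type u} [TopologicalSpace M] [ChartedSpace (EuclideanSpace ℝ (Fin m)) M]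
  {N : Type v} [TopologicalSpace N] [ChartedSpace (EuclideanSpace ℝ (Fin n)) N]
  {F : Type*} [NormedAddCommGroup F] [NormedSpace ℝ F]
  {p : M → N}

/-- The charts `c` and `b` and the linear splitting `e` bring `p` to the normal form
`(u, w) ↦ u`. -/
structure IsNormalForm (p : M → N) (c : OpenPartialHomeomorph M (EuclideanSpace ℝ (Fin m)))
    (b : OpenPartialHomeomorph N (EuclideanSpace ℝ (Fin n)))
    (e : EuclideanSpace ℝ (Fin m) ≃L[ℝ] EuclideanSpace ℝ (Fin n) × F) : Prop where
  mem_maximalAtlas : c ∈ IsManifold.maximalAtlas (𝓡 m) ∞ M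
  mem_maximalAtlas' : b ∈ IsManifold.maximalAtlas (𝓡 n) ∞ N
  map_source : ∀ y ∈ c.source, p y ∈ b.source
  fst_eq : ∀ y ∈ c.source, (e (c y)).1 = b (p y)

lemma exists_isNormalForm (hp : Manifold.IsSubmersion (𝓡 m) (𝓡 n) ∞ p) (x : M) :
    ∃ (F : Type) (_ : NormedAddCommGroup F) (_ : NormedSpace ℝ F)
      (c : OpenPartialHomeomorph M (EuclideanSpace ℝ (Fin m)))
      (b : OpenPartialHomeomorph N (EuclideanSpace ℝ (Fin n)))
      (e : EuclideanSpace ℝ (Fin m) ≃L[ℝ] EuclideanSpace ℝ (Fin n) × F),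
      IsNormalForm p c b e ∧ x ∈ c.source := by
  obtain ⟨F, _, _, hF⟩ := hp
  have h := hF x
  refine ⟨F, _, _, h.domChart, h.codChart, h.equiv, ⟨h.domChart_mem_maximalAtlas,
    h.codChart_mem_maximalAtlas, fun y hy ↦ h.source_subset_preimage_source hy, fun y hy ↦ ?_⟩,
    h.mem_domChart_source⟩
  have h1 : h.domChart y ∈ (h.domChart.extend (𝓡 m)).target := by
    simpa [mfld_simps] using h.domChart.map_source hy
  have h2 := h.writtenInCharts h1
  have h3 : (h.domChart.extend (𝓡 m)).symm (h.domChart y) = y := by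
    simp [mfld_simps, h.domChart.left_inv hy]
  simp only [Function.comp_apply] at h2
  rw [h3] at h2
  simpa [mfld_simps] using h2.symm

/-- The local homeomorphism `τ` acting on the first factor of a splitting. -/
noncomputable def liftFst (e : EuclideanSpace ℝ (Fin m) ≃L[ℝ] EuclideanSpace ℝ (Fin n) × F)
    (τ : OpenPartialHomeomorph (EuclideanSpace ℝ (Fin n)) (EuclideanSpace ℝ (Fin n))) :
    OpenPartialHomeomorph (EuclideanSpace ℝ (Fin m)) (EuclideanSpace ℝ (Fin m)) :=
  (e.toHomeomorph.toOpenPartialHomeomorph.trans (τ.prod (OpenPartialHomeomorph.refl F))).trans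
    e.symm.toHomeomorph.toOpenPartialHomeomorph

section

variable (e : EuclideanSpace ℝ (Fin m) ≃L[ℝ] EuclideanSpace ℝ (Fin n) × F)
  (τ : OpenPartialHomeomorph (EuclideanSpace ℝ (Fin n)) (EuclideanSpace ℝ (Fin n)))

lemma mem_liftFst_source (z : EuclideanSpace ℝ (Fin m)) :
    z ∈ (liftFst e τ).source ↔ (e z).1 ∈ τ.source := by
  simp [liftFst, mfld_simps]

lemma mem_liftFst_target (z : EuclideanSpace ℝ (Fin m)) :
    z ∈ (liftFst e τ).target ↔ (e z).1 ∈ τ.target := by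
  simp [liftFst, mfld_simps]

variable {e τ}

lemma contDiffAt_fst_comp {σ : EuclideanSpace ℝ (Fin n) → EuclideanSpace ℝ (Fin n)}
    {z : EuclideanSpace ℝ (Fin m)} (hσ : ContDiffAt ℝ ∞ σ (e z).1) :
    ContDiffAt ℝ ∞ (fun z ↦ e.symm (σ (e z).1, (e z).2)) z := by
  have h1 : ContDiffAt ℝ ∞ (fun z ↦ (e z).1) z := (contDiff_fst.comp e.contDiff).contDiffAt
  have h2 : ContDiffAt ℝ ∞ (fun z ↦ (e z).2) z := (contDiff_snd.comp e.contDiff).contDiffAt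
  exact e.symm.contDiff.contDiffAt.comp z ((hσ.comp z h1).prodMk h2)

end

variable {c : OpenPartialHomeomorph M (EuclideanSpace ℝ (Fin m))}
  {b Ψ : OpenPartialHomeomorph N (EuclideanSpace ℝ (Fin n))}
  {e : EuclideanSpace ℝ (Fin m) ≃L[ℝ] EuclideanSpace ℝ (Fin n) × F}

lemma contDiffAt_transition (hb : b ∈ IsManifold.maximalAtlas (𝓡 n) ∞ N)
    (hΨ : Ψ ∈ IsManifold.maximalAtlas (𝓡 n) ∞ N) {z : EuclideanSpace ℝ (Fin n)}
    (hz : z ∈ (b.symm ≫ₕ Ψ).source) : ContDiffAt ℝ ∞ (b.symm ≫ₕ Ψ) z := by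
  rw [OpenPartialHomeomorph.trans_source] at hz
  rw [← contMDiffAt_iff_contDiffAt]
  exact ContMDiffAt.comp (g := Ψ) (f := b.symm) (I' := 𝓡 n) z
    (contMDiffAt_of_mem_maximalAtlas hΨ hz.2) (contMDiffAt_symm_of_mem_maximalAtlas hb hz.1)

/-- The differential of a map that reads as a linear map in charts. -/
lemma coordDeriv_mfderiv_eq {Φ : OpenPartialHomeomorph M (EuclideanSpace ℝ (Fin m))}
    (hΦ : Φ ∈ IsManifold.maximalAtlas (𝓡 m) ∞ M) (hΨ : Ψ ∈ IsManifold.maximalAtlas (𝓡 n) ∞ N)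
    {y : M} (hy : y ∈ Φ.source) (hpy : p y ∈ Ψ.source) (hp : MDifferentiableAt (𝓡 m) (𝓡 n) p y)
    {π : EuclideanSpace ℝ (Fin m) →L[ℝ] EuclideanSpace ℝ (Fin n)}
    (h : π ∘ Φ =ᶠ[𝓝 y] Ψ ∘ p) (v : TangentSpace (𝓡 m) y) :
    coordDeriv Ψ (p y) (mfderiv (𝓡 m) (𝓡 n) p y v) = π (coordDeriv Φ y v) := by
  have h1 := HasMFDerivAt.comp y ((mdifferentiable_of_mem_maximalAtlas
    hΨ).mdifferentiableAt hpy).hasMFDerivAt hp.hasMFDerivAt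
  have h2 := HasMFDerivAt.comp y π.hasMFDerivAt
    ((mdifferentiable_of_mem_maximalAtlas hΦ).mdifferentiableAt hy).hasMFDerivAt
  exact DFunLike.congr_fun (hasMFDerivAt_unique (h1.congr_of_eventuallyEq h) h2) v

variable [IsManifold (𝓡 m) ∞ M]

/-- Changes the base coordinates from `b` to `Ψ` inside the chart upstairs, so that `p` stays a
linear projection when read against the chart adapted to a slice. -/
lemma IsNormalForm.trans_liftFst_mem_maximalAtlas (h : IsNormalForm p c b e)
    (hΨ : Ψ ∈ IsManifold.maximalAtlas (𝓡 n) ∞ N) :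
    c.trans (liftFst e (b.symm ≫ₕ Ψ)) ∈ IsManifold.maximalAtlas (𝓡 m) ∞ M := by
  refine OpenPartialHomeomorph.mem_maximalAtlas_of_contMDiffOn _ (fun y hy ↦ ?_) fun z hz ↦ ?_
  · rw [OpenPartialHomeomorph.trans_source] at hy
    refine ContMDiffAt.contMDiffWithinAt (ContMDiffAt.comp
      (g := liftFst e (b.symm ≫ₕ Ψ)) (f := c) (I' := 𝓡 m) y ?_
      (contMDiffAt_of_mem_maximalAtlas h.mem_maximalAtlas hy.1))
    exact (contDiffAt_fst_comp (contDiffAt_transition h.mem_maximalAtlas' hΨ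
      ((mem_liftFst_source _ _ _).1 hy.2))).contMDiffAt
  · rw [OpenPartialHomeomorph.trans_target] at hz
    refine ContMDiffAt.contMDiffWithinAt (ContMDiffAt.comp
      (g := c.symm) (f := (liftFst e (b.symm ≫ₕ Ψ)).symm) (I' := 𝓡 m) z
      (contMDiffAt_symm_of_mem_maximalAtlas h.mem_maximalAtlas hz.2) ?_)
    have := (mem_liftFst_target _ _ _).1 hz.1
    rw [← OpenPartialHomeomorph.symm_source, OpenPartialHomeomorph.trans_symm_eq_symm_trans_symm,
      OpenPartialHomeomorph.symm_symm] at this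
    exact (contDiffAt_fst_comp (contDiffAt_transition hΨ h.mem_maximalAtlas' this)).contMDiffAt

/-- The preimage of an integral slice under a submersion is locally an integral slice. -/
lemma IsNormalForm.exists_slice {Δ : Set (TangentBundle (𝓡 n) N)}
    {W : Submodule ℝ (EuclideanSpace ℝ (Fin n))}
    (h : IsNormalForm p c b e) (hp : ContMDiff (𝓡 m) (𝓡 n) ∞ p) (hΨ : IsIntegralSlice Δ Ψ W) :
    ∃ Φ W', IsIntegralSlice (tangentMap (𝓡 m) (𝓡 n) p ⁻¹' Δ) Φ W' ∧
      slice Φ W' = c.source ∩ p ⁻¹' slice Ψ W := by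
  let Φ := c.trans (liftFst e (b.symm ≫ₕ Ψ))
  let π : EuclideanSpace ℝ (Fin m) →L[ℝ] EuclideanSpace ℝ (Fin n) :=
    (ContinuousLinearMap.fst ℝ _ F).comp e.toContinuousLinearMap
  have hΦm : Φ ∈ IsManifold.maximalAtlas (𝓡 m) ∞ M :=
    h.trans_liftFst_mem_maximalAtlas hΨ.mem_maximalAtlas
  have hsrc : ∀ y, y ∈ Φ.source ↔ y ∈ c.source ∧ p y ∈ Ψ.source := fun y ↦ by
    rw [OpenPartialHomeomorph.trans_source]
    refine and_congr_right fun hy ↦ ?_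
    rw [mem_preimage, mem_liftFst_source, h.fst_eq y hy, OpenPartialHomeomorph.trans_source]
    simp [b.left_inv (h.map_source y hy), b.map_source (h.map_source y hy)]
  have hπ : ∀ y ∈ c.source, π (Φ y) = Ψ (p y) := fun y hy ↦ by
    have h1 : π (Φ y) = Ψ (b.symm (e (c y)).1) :=
      congrArg Prod.fst (e.apply_symm_apply ((b.symm ≫ₕ Ψ) (e (c y)).1, (e (c y)).2))
    rw [h1, h.fst_eq y hy, b.left_inv (h.map_source y hy)]
  have hs : slice Φ (W.comap π.toLinearMap) = c.source ∩ p ⁻¹' slice Ψ W := by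
    ext y
    constructor
    · rintro ⟨hy, hyW⟩
      obtain ⟨hyc, hyp⟩ := (hsrc y).1 hy
      exact ⟨hyc, hyp, by rw [← hπ y hyc]; exact hyW⟩
    · rintro ⟨hyc, hyp, hyW⟩
      refine ⟨(hsrc y).2 ⟨hyc, hyp⟩, ?_⟩
      rw [← hπ y hyc] at hyW
      exact hyW
  refine ⟨Φ, _, ⟨hΦm, fun y hy v ↦ ?_⟩, hs⟩
  have hy' := hs ▸ hy
  refine (hΨ.mem_fiber_iff (p y) hy'.2 (mfderiv (𝓡 m) (𝓡 n) p y v)).trans ?_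
  rw [coordDeriv_mfderiv_eq hΦm hΨ.mem_maximalAtlas hy.1 hy'.2.1
    ((hp y).mdifferentiableAt (by simp)) (π := π) ?_ v]
  · rfl
  · filter_upwards [c.open_source.mem_nhds hy'.1] with y' hy' using hπ y' hy'

variable [IsManifold (𝓡 n) ∞ N]

/-- The preimage of a singular distribution under a submersion is a singular distribution. -/
theorem isSingularDistribution_preimage (hp : Manifold.IsSubmersion (𝓡 m) (𝓡 n) ∞ p)
    {Δ : Set (TangentBundle (𝓡 n) N)} (hΔ : IsSingularDistribution Δ) :
    IsSingularDistribution (tangentMap (𝓡 m) (𝓡 n) p ⁻¹' Δ) where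
  subspace x := by
    obtain ⟨V, hV⟩ := hΔ.subspace (p x)
    refine ⟨V.comap (mfderiv (𝓡 m) (𝓡 n) p x).toLinearMap, ?_⟩
    change (mfderiv (𝓡 m) (𝓡 n) p x) ⁻¹' V = (mfderiv (𝓡 m) (𝓡 n) p x) ⁻¹' fiber Δ (p x)
    rw [hV]
  smooth x v hv := by
    obtain ⟨F, _, _, c, b, e, h, hx⟩ := exists_isNormalForm hp x
    obtain ⟨U, X, hU, hxU, hX, hXv, hXΔ⟩ := hΔ.smooth (p x) (mfderiv (𝓡 m) (𝓡 n) p x v) hv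
    have hpd : ∀ y ∈ c.source, ∀ w, coordDeriv b (p y) (mfderiv (𝓡 m) (𝓡 n) p y w) =
        (e (coordDeriv c y w)).1 := fun y hy w ↦ by
      refine coordDeriv_mfderiv_eq h.mem_maximalAtlas h.mem_maximalAtlas' hy (h.map_source y hy)
        ((hp.contMDiff y).mdifferentiableAt (by simp))
        (π := (ContinuousLinearMap.fst ℝ _ F).comp e.toContinuousLinearMap) ?_ w
      filter_upwards [c.open_source.mem_nhds hy] with y' hy' using h.fst_eq y' hy'
    let Y : EuclideanSpace ℝ (Fin n) → EuclideanSpace ℝ (Fin n) :=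
      fun z ↦ coordDeriv b (b.symm z) (X (b.symm z))
    have hYb : ∀ y ∈ c.source, Y (e (c y)).1 = coordDeriv b (p y) (X (p y)) := fun y hy ↦ by
      simp only [Y]
      rw [h.fst_eq y hy, b.left_inv (h.map_source y hy)]
    -- The lifted field has base component `X` and the constant fibre component of `v`, so it
    -- projects to `X` and equals `v` at `x`.
    obtain ⟨X', hX', hX'Z⟩ := exists_field_of_coordDeriv h.mem_maximalAtlas
      fun z ↦ e.symm (Y (e z).1, (e (coordDeriv c x v)).2)
    refine ⟨c.source ∩ p ⁻¹' U, X', c.open_source.inter (hU.preimage hp.contMDiff.continuous),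
      ⟨hx, hxU⟩, fun y hy ↦ (hX' y hy.1 ?_).contMDiffWithinAt, ?_, fun y hy ↦ ?_⟩
    · have hY : ContDiffAt ℝ ∞ Y (e (c y)).1 := by
        rw [h.fst_eq y hy.1]
        exact contDiffAt_coordDeriv_field h.mem_maximalAtlas' (h.map_source y hy.1)
          (hX.contMDiffAt (hU.mem_nhds hy.2))
      have h1 : ContDiffAt ℝ ∞ (fun z ↦ (e z).1) (c y) :=
        (contDiff_fst.comp e.contDiff).contDiffAt
      have h2 : ContDiffAt ℝ ∞ (fun z ↦ Y (e z).1) (c y) :=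
        ContDiffAt.comp (g := Y) (f := fun z ↦ (e z).1) (c y) hY h1
      exact e.symm.contDiff.contDiffAt.comp (c y) (h2.prodMk contDiffAt_const)
    · refine coordDeriv_injective h.mem_maximalAtlas hx ?_
      rw [hX'Z x hx, hYb x hx, hXv, hpd x hx, Prod.mk.eta, e.symm_apply_apply]
    · change mfderiv (𝓡 m) (𝓡 n) p y (X' y) ∈ fiber Δ (p y)
      have h1 : mfderiv (𝓡 m) (𝓡 n) p y (X' y) = X (p y) := by
        refine coordDeriv_injective h.mem_maximalAtlas' (h.map_source y hy.1) ?_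
        rw [hpd y hy.1, hX'Z y hy.1, e.apply_symm_apply, hYb y hy.1]
      rw [h1]
      exact hXΔ _ hy.2

end Submersion

/-! ### The leaf topology of the preimage distribution. -/

section Preimage

variable {m n : ℕ} {M : Type u} [TopologicalSpace M] [ChartedSpace (EuclideanSpace ℝ (Fin m)) M]
  [IsManifold (𝓡 m) ∞ M]
  {N : Type v} [TopologicalSpace N] [ChartedSpace (EuclideanSpace ℝ (Fin n)) N]
  {p : M → N} {Δ : Set (TangentBundle (𝓡 n) N)}

lemma hasIntegralSlices_preimage (hp : Manifold.IsSubmersion (𝓡 m) (𝓡 n) ∞ p)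
    (hS : HasIntegralSlices Δ) : HasIntegralSlices (tangentMap (𝓡 m) (𝓡 n) p ⁻¹' Δ) := fun x ↦ by
  obtain ⟨F, _, _, c, b, e, h, hx⟩ := exists_isNormalForm hp x
  obtain ⟨Ψ, W, hΨ, hxΨ⟩ := hS (p x)
  obtain ⟨Φ, W', hΦ, hs⟩ := h.exists_slice hp.contMDiff hΨ
  exact ⟨Φ, W', hΦ, hs ▸ ⟨hx, hxΨ⟩⟩

variable [IsManifold (𝓡 n) ∞ N]

/-- A map `p`, between the leaf spaces of a preimage distribution and of the distribution. -/
def leafMap (p : M → N) (Δ : Set (TangentBundle (𝓡 n) N)) :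
    LeafSpace (tangentMap (𝓡 m) (𝓡 n) p ⁻¹' Δ) → LeafSpace Δ :=
  fun x ↦ leafEquiv Δ (p ((leafEquiv _).symm x))

/-- The leaf topology of the preimage distribution is the coarsest one for which `p` and the
identity of `M` are continuous. -/
lemma nhds_leafSpace_preimage (hp : Manifold.IsSubmersion (𝓡 m) (𝓡 n) ∞ p)
    (hΔ : IsSingularDistribution Δ) (hS : HasIntegralSlices Δ)
    (x : LeafSpace (tangentMap (𝓡 m) (𝓡 n) p ⁻¹' Δ)) :
    𝓝 x = comap (leafEquiv _).symm (𝓝 ((leafEquiv _).symm x)) ⊓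
      comap (leafMap p Δ) (𝓝 (leafMap p Δ x)) := by
  obtain ⟨x, rfl⟩ := (leafEquiv (tangentMap (𝓡 m) (𝓡 n) p ⁻¹' Δ)).surjective x
  obtain ⟨F, _, _, c, b, e, h, hx⟩ := exists_isNormalForm hp x
  obtain ⟨Ψ, W, hΨ, hxΨ⟩ := hS (p x)
  obtain ⟨Φ, W', hΦ, hs⟩ := h.exists_slice hp.contMDiff hΨ
  have h1 : 𝓝 (leafMap p Δ (leafEquiv (tangentMap (𝓡 m) (𝓡 n) p ⁻¹' Δ) x)) = _ :=
    hΨ.nhds_leafEquiv hΔ hxΨ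
  -- Upstairs the slice is locally the preimage of the slice below; by continuity of `p`,
  -- intersecting with the pullback of the full neighbourhood filter of `p x` changes nothing.
  have h2 : 𝓝[slice Φ W'] x = 𝓝 x ⊓ comap p (𝓝[slice Ψ W] (p x)) := by
    have h3 : 𝓝 x ≤ comap p (𝓝 (p x)) := (hp.contMDiff.continuous.tendsto x).le_comap
    rw [hs, nhdsWithin_inter', nhdsWithin_eq_nhds.2 (c.open_source.mem_nhds hx), nhdsWithin,
      comap_inf, comap_principal, ← inf_assoc, inf_eq_left.2 h3]
  rw [h1, hΦ.nhds_leafEquiv (isSingularDistribution_preimage hp hΔ) (hs ▸ ⟨hx, hxΨ⟩), h2,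
    Equiv.symm_apply_apply, ← comap_equiv_symm, ← comap_equiv_symm, comap_inf, comap_comap,
    comap_comap]
  rfl

lemma isInducing_leafSpace_preimage (hp : Manifold.IsSubmersion (𝓡 m) (𝓡 n) ∞ p)
    (hΔ : IsSingularDistribution Δ) (hS : HasIntegralSlices Δ) :
    IsInducing fun x : LeafSpace (tangentMap (𝓡 m) (𝓡 n) p ⁻¹' Δ) ↦
      ((leafEquiv _).symm x, leafMap p Δ x) := by
  refine isInducing_iff_nhds.2 fun x ↦ ?_
  rw [nhds_leafSpace_preimage hp hΔ hS, nhds_prod_eq, comap_prod]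
  rfl

lemma continuous_leafMap (hp : Manifold.IsSubmersion (𝓡 m) (𝓡 n) ∞ p)
    (hΔ : IsSingularDistribution Δ) (hS : HasIntegralSlices Δ) :
    Continuous (leafMap (m := m) (M := M) p Δ) :=
  continuous_snd.comp (isInducing_leafSpace_preimage hp hΔ hS).continuous

omit [IsManifold (𝓡 m) ∞ M] [IsManifold (𝓡 n) ∞ N] in
lemma isOpenMap_of_isSubmersion (hp : Manifold.IsSubmersion (𝓡 m) (𝓡 n) ∞ p) : IsOpenMap p := by
  refine IsOpenMap.of_nhds_le fun x ↦ ?_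
  obtain ⟨F, _, _, c, b, e, h, hx⟩ := exists_isNormalForm hp x
  have hpx := h.map_source x hx
  have hπ : IsOpenMap fun z ↦ (e z).1 := isOpenMap_fst.comp e.toHomeomorph.isOpenMap
  have h1 : map (fun y ↦ b.symm (e (c y)).1) (𝓝 x) = 𝓝 (p x) := by
    have h2 : map (fun z ↦ (e z).1) (𝓝 (c x)) = 𝓝 (b (p x)) := by
      rw [← h.fst_eq x hx]
      exact hπ.map_nhds_eq (continuous_fst.comp e.continuous).continuousAt
    have h3 := b.symm.map_nhds_eq (b.map_source hpx)
    have h4 : (fun y ↦ b.symm (e (c y)).1) = b.symm ∘ (fun z ↦ (e z).1) ∘ c := rfl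
    rw [h4, ← map_map, ← map_map, c.map_nhds_eq hx, h2, h3, b.left_inv hpx]
  rw [← h1]
  refine (map_congr ?_).le
  filter_upwards [c.open_source.mem_nhds hx] with y hy
  rw [h.fst_eq y hy, b.left_inv (h.map_source y hy)]

/-- A basic neighbourhood is `A ∩ p⁻¹(B)`, with `A` a neighbourhood in `M` and `B` a leafwise one in
`N`. Its image is `p(A) ∩ B`, and `p(A)` is a neighbourhood because a submersion is open. -/
lemma isOpenMap_leafMap (hp : Manifold.IsSubmersion (𝓡 m) (𝓡 n) ∞ p)
    (hΔ : IsSingularDistribution Δ) (hS : HasIntegralSlices Δ) :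
    IsOpenMap (leafMap (m := m) (M := M) p Δ) := by
  refine IsOpenMap.of_nhds_le fun x V hV ↦ ?_
  rw [mem_map, nhds_leafSpace_preimage hp hΔ hS] at hV
  obtain ⟨_, ⟨A, hA, hA'⟩, _, ⟨B, hB, hB'⟩, hAB⟩ := mem_inf_iff_superset.1 hV
  have hpA : p '' A ∈ 𝓝 (p ((leafEquiv _).symm x)) :=
    (isOpenMap_of_isSubmersion hp).image_mem_nhds hA
  have h1 : (leafEquiv Δ).symm ⁻¹' (p '' A) ∈ 𝓝 (leafMap p Δ x) :=
    (continuous_leafEquiv_symm hΔ hS).continuousAt.preimage_mem_nhds hpA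
  filter_upwards [h1, hB] with y hy hyB
  obtain ⟨a, ha, hay⟩ := hy
  have h2 : leafMap p Δ (leafEquiv (tangentMap (𝓡 m) (𝓡 n) p ⁻¹' Δ) a) = y := by
    change leafEquiv Δ (p a) = y
    rw [hay, Equiv.apply_symm_apply]
  have := hAB ⟨hA' (a := leafEquiv _ a) ha, hB' (a := leafEquiv _ a) (by rwa [mem_preimage, h2])⟩
  rwa [mem_preimage, h2] at this

/-- On a fibre `leafMap` is constant, so the induced leaf topology is the topology from `M`, where
the fibre is connected. -/
lemma isConnected_leafMap_fiber (hp : Manifold.IsSubmersion (𝓡 m) (𝓡 n) ∞ p)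
    (hΔ : IsSingularDistribution Δ) (hS : HasIntegralSlices Δ)
    (hconn : ∀ y : N, IsConnected (p ⁻¹' {y})) (y : LeafSpace Δ) :
    IsConnected (leafMap (m := m) (M := M) p Δ ⁻¹' {y}) := by
  obtain ⟨y, rfl⟩ := (leafEquiv Δ).surjective y
  have h1 : leafMap p Δ ⁻¹' {leafEquiv Δ y} =
      leafEquiv (tangentMap (𝓡 m) (𝓡 n) p ⁻¹' Δ) '' (p ⁻¹' {y}) := by
    rw [Equiv.image_eq_preimage_symm]
    ext x
    exact (leafEquiv Δ).injective.eq_iff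
  rw [h1]
  refine (hconn y).image _ ?_
  rw [(isInducing_leafSpace_preimage hp hΔ hS).continuousOn_iff]
  refine ContinuousOn.prodMk continuousOn_id
    (ContinuousOn.congr (f := fun _ ↦ leafEquiv Δ y) continuousOn_const fun x hx ↦ ?_)
  exact congrArg (leafEquiv Δ) hx

end Preimage

end SingularFoliation

/-! ### Comparison of the leaves. -/

open SingularFoliation in
theorem proposition4 {m n : ℕ}
    {M : Type u} [TopologicalSpace M] [ChartedSpace (EuclideanSpace ℝ (Fin m)) M]
    [IsManifold (𝓡 m) ∞ M] [T2Space M] [SecondCountableTopology M]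
    {N : Type v} [TopologicalSpace N] [ChartedSpace (EuclideanSpace ℝ (Fin n)) N]
    [IsManifold (𝓡 n) ∞ N] [T2Space N] [SecondCountableTopology N]
    (p : M → N) (hp : Manifold.IsSubmersion (𝓡 m) (𝓡 n) ∞ p) (hsurj : Function.Surjective p)
    (hconn : ∀ y : N, IsConnected (p ⁻¹' {y}))
    (Δ : Set (TangentBundle (𝓡 n) N)) (hΔ : SingularFoliation.IsIntegrable Δ) :
    SingularFoliation.IsIntegrable (tangentMap (𝓡 m) (𝓡 n) p ⁻¹' Δ) ∧
    (∀ A : Set M, A ∈ SingularFoliation.leaves (tangentMap (𝓡 m) (𝓡 n) p ⁻¹' Δ) ↔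
      ∃ L ∈ SingularFoliation.leaves Δ, A = p ⁻¹' L) := by
  have hd := hΔ.isSingularDistribution
  have hS := hΔ.hasIntegralSlices
  have hd' := isSingularDistribution_preimage hp hd
  have hS' := hasIntegralSlices_preimage hp hS
  refine ⟨⟨hd', fun x ↦ ?_⟩, fun A ↦ ?_⟩
  · obtain ⟨L, hx, hL, -⟩ := exists_connected_integral hd' hS' x
    exact ⟨L, hx, hL⟩
  have hcont := continuous_leafMap hp hd hS
  have hopen := isOpenMap_leafMap hp hd hS
  have hsurj' : Function.Surjective (leafMap (m := m) (M := M) p Δ) :=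
    (leafEquiv Δ).surjective.comp (hsurj.comp (leafEquiv _).symm.surjective)
  -- An open continuous surjection is a quotient map, and a quotient map with connected fibres pulls
  -- components back to components.
  have hcomp : ∀ x : M, leafMap p Δ ⁻¹' connectedComponent (leafEquiv Δ (p x)) =
      connectedComponent (leafEquiv (tangentMap (𝓡 m) (𝓡 n) p ⁻¹' Δ) x) := fun x ↦
    (hopen.isQuotientMap hcont hsurj').isCoinducing.preimage_connectedComponent
      (isConnected_leafMap_fiber hp hd hS hconn) (leafEquiv _ x)
  have hcount : ∀ x : M, SecondCountableTopology
      (connectedComponent (leafEquiv (tangentMap (𝓡 m) (𝓡 n) p ⁻¹' Δ) x)) ↔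
      SecondCountableTopology (connectedComponent (leafEquiv Δ (p x))) := fun x ↦ by
    rw [← hcomp x]
    set C := connectedComponent (leafEquiv Δ (p x))
    constructor
    · intro h
      have h1 : IsOpenMap (C.restrictPreimage (leafMap (m := m) (M := M) p Δ)) :=
        hopen.restrictPreimage C
      exact (h1.isQuotientMap (hcont.restrictPreimage)
        (C.restrictPreimage_surjective hsurj')).secondCountableTopology h1
    · intro h
      -- The preimage of `C` has the topology induced from `M × C`, a product of second countable
      -- spaces.
      have h1 : Topology.IsInducing fun a : leafMap (m := m) (M := M) p Δ ⁻¹' C ↦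
          ((leafEquiv _).symm a.1, C.restrictPreimage (leafMap p Δ) a) := by
        refine Topology.IsInducing.of_comp (g := fun q : M × C ↦ (q.1, q.2.1)) ?_ (by fun_prop) ?_
        · exact ((continuous_leafEquiv_symm hd' hS').comp continuous_subtype_val).prodMk
            hcont.restrictPreimage
        · exact (isInducing_leafSpace_preimage hp hd hS).comp Topology.IsInducing.subtypeVal
      exact h1.secondCountableTopology
  rw [mem_leaves_iff hd' hS']
  constructor
  · rintro ⟨x, rfl, hx⟩
    refine ⟨_, (mem_leaves_iff hd hS).2 ⟨p x, rfl, (hcount x).1 hx⟩, ?_⟩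
    rw [← hcomp x]
    rfl
  · rintro ⟨_, hL, rfl⟩
    obtain ⟨y, rfl, hy⟩ := (mem_leaves_iff hd hS).1 hL
    obtain ⟨x, rfl⟩ := hsurj y
    refine ⟨x, ?_, (hcount x).2 hy⟩
    rw [← hcomp x]
    rfl
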